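/- Let $Q_1,Q_2,Q_3\in\mathbb R[u,v,w]$ be quadratic forms such that the plane quartic $\Delta=(Q_1Q_3-Q_2^2=0)\subset\mathbb P^2_{\mathbb R}$ is smooth. Call a simple closed curve in $\mathbb P^2(\mathbb R)$ that separates $\mathbb P^2(\mathbb R)$ an oval. Let the outside $U_\Delta$ be the non-orientable part of $\mathbb P^2(\mathbb R)\setminus\Delta(\mathbb R)$, that is, the union of its non-orientable connected components. Let $$W=\bigl(t_0^2Q_1+2t_0t_1Q_2+t_1^2Q_3=0\bigr)\subset\mathbb P^1_{[t_0:t_1]}\times\mathbb P^2_{[u:v:w]},$$ and let $\pi_2'\colon W\to\mathbb P^2$ be the second projection. Suppose that $\Delta(\mathbb R)$ is the disjoint union of four ovals. Then $$U_\Delta=(Q_1Q_3-Q_2^2<0)_{\mathbb R}:=\{P\in\mathbb P^2(\mathbb R) : (Q_1Q_3-Q_2^2)(P)<0\}.$$ Consequently, every real bitangent of $\Delta$ splits on $W$: if $\ell\subset\mathbb P^2_{\mathbb R}$ is a line such that $\Delta$ cuts out on $\ell_{\mathbb C}$ a divisor of the form $2D$, then the preimage $(\pi_2')^{-1}(\ell)$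 is the union of two distinct curves defined over $\mathbb R$, each of which $\pi_2'$ maps isomorphically onto $\ell$. -/

import Mathlib

noncomputable section

open MvPolynomial
open scoped LinearAlgebra.Projectivization

namespace RealQuartic

/-! ### The real projective plane -/

/-- The real projective plane `ℙ²(ℝ)`. -/
abbrev RP2 : Type := ℙ ℝ (Fin 3 → ℝ)

/-- The Euclidean topology on `ℙ²(ℝ)`: the quotient topology from `ℝ³ ∖ {0}`. -/
instance : TopologicalSpace RP2 :=
  inferInstanceAs (TopologicalSpace (Quotient (projectivizationSetoid ℝ (Fin 3 → ℝ))))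

/-- The real points of the plane curve defined by the homogeneous polynomial `f`. -/
def zeroLocus (f : MvPolynomial (Fin 3) ℝ) : Set RP2 := {P | eval P.rep f = 0}

/-- The set `(f < 0)_ℝ` of real points at which the form `f` is negative. For `f` homogeneous of
even degree this does not depend on the representative of the point. -/
def negLocus (f : MvPolynomial (Fin 3) ℝ) : Set RP2 := {P | eval P.rep f < 0}

/-- The homogeneous polynomial `f` defines a smooth plane curve: the gradient of `f` vanishes at
no complex point of the curve. -/
def IsSmoothCurve (f : MvPolynomial (Fin 3) ℝ) : Prop :=
  ∀ v : Fin 3 → ℂ, v ≠ 0 → aeval v f = 0 → ∃ i, aeval v (pderiv i f) ≠ 0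

/-! ### Ovals -/

/-- An oval in `ℙ²(ℝ)`: a simple closed curve that separates `ℙ²(ℝ)`. -/
def IsOval (C : Set RP2) : Prop := Nonempty (C ≃ₜ Circle) ∧ ¬ IsPreconnected Cᶜ

/-- The set `S` consists of exactly `n` pairwise disjoint ovals. -/
def ConsistsOfOvals (n : ℕ) (S : Set RP2) : Prop :=
  ∃ C : Fin n → Set RP2, (∀ i, IsOval (C i)) ∧ Pairwise (fun i j => Disjoint (C i) (C j)) ∧
    ⋃ i, C i = S

/-! ### Orientability of open subsets of the real projective plane -/

/-- The domain `x_i ≠ 0` of the `i`-th standard affine chart. -/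
def chartDomain (i : Fin 3) : Set RP2 := {P | P.rep i ≠ 0}

/-- The `i`-th standard affine chart: the coordinates `x_j / x_i` for `j ≠ i`, in increasing order
of `j`. -/
def chart (i : Fin 3) (P : RP2) : Fin 2 → ℝ := fun k => P.rep (i.succAbove k) / P.rep i

/-- The change of coordinates from the `i`-th to the `j`-th standard affine chart. -/
def transition (i j : Fin 3) (y : Fin 2 → ℝ) : Fin 2 → ℝ := fun k =>
  (i.insertNth 1 y : Fin 3 → ℝ) (j.succAbove k) / (i.insertNth 1 y : Fin 3 → ℝ) j

/-- The open set `U` is orientable: each affine chart can be given, over `U`, a locally constant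
sign such that, after correcting the charts by these signs, all coordinate changes over `U` have
positive Jacobian determinant. -/
def IsOrientable (U : Set RP2) : Prop :=
  ∃ ε : Fin 3 → RP2 → ℤˣ,
    (∀ i, ContinuousOn (ε i) (U ∩ chartDomain i)) ∧
    ∀ i j, ∀ P ∈ U ∩ chartDomain i ∩ chartDomain j,
      0 < ((ε i P : ℤ) : ℝ) * ((ε j P : ℤ) : ℝ) *
        (fderiv ℝ (transition i j) (chart i P)).det

/-- The outside `U_f` of the curve `f = 0`: the non-orientable part of the complement of its real
locus, that is, the points that lie in a non-orientable connected component of the complement. -/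
def outside (f : MvPolynomial (Fin 3) ℝ) : Set RP2 :=
  {P | P ∈ (zeroLocus f)ᶜ ∧ ¬ IsOrientable (connectedComponentIn (zeroLocus f)ᶜ P)}

/-! ### Bitangents and the del Pezzo surface -/

/-- The complex points of the line `l 0 * u + l 1 * v + l 2 * w = 0`. -/
def complexLine (l : Fin 3 → ℝ) : Set (ℙ ℂ (Fin 3 → ℂ)) :=
  {P | ∑ i, (l i : ℂ) * P.rep i = 0}

/-- The line with real coefficients `l` is a bitangent of the plane quartic `f = 0`: the divisor
that the quartic cuts out on the complexified line is of the form `2 D`, where `D` is the divisor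
of degree two that a quadratic form `g` cuts out (so `D = P₁ + P₂` for the two points of tangency,
which may coincide or be complex conjugate). -/
def IsRealBitangent (f : MvPolynomial (Fin 3) ℝ) (l : Fin 3 → ℝ) : Prop :=
  l ≠ 0 ∧ ∃ g h : MvPolynomial (Fin 3) ℂ, g.IsHomogeneous 2 ∧
    map (algebraMap ℝ ℂ) f = g ^ 2 + (∑ i, C (l i : ℂ) * X i) * h

/-- The complex points of the surface
`W = (t₀² Q₁ + 2 t₀ t₁ Q₂ + t₁² Q₃ = 0)` in `ℙ¹ × ℙ²`. -/
def delPezzo (Q₁ Q₂ Q₃ : MvPolynomial (Fin 3) ℝ) :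
    Set (ℙ ℂ (Fin 2 → ℂ) × ℙ ℂ (Fin 3 → ℂ)) :=
  {p | p.1.rep 0 ^ 2 * aeval p.2.rep Q₁ + 2 * p.1.rep 0 * p.1.rep 1 * aeval p.2.rep Q₂ +
    p.1.rep 1 ^ 2 * aeval p.2.rep Q₃ = 0}

/-- `Z` is (the set of complex points of) a curve in `ℙ¹ × ℙ²`, defined over `ℝ`, that the second
projection maps isomorphically onto the line `l`: it is the graph of a morphism `[A 0 : A 1]` over
`ℝ` from the line to `ℙ¹`. -/
def IsRealLineOver (l : Fin 3 → ℝ) (Z : Set (ℙ ℂ (Fin 2 → ℂ) × ℙ ℂ (Fin 3 → ℂ))) : Prop :=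
  ∃ (d : ℕ) (A : Fin 2 → MvPolynomial (Fin 3) ℝ),
    (∀ k, (A k).IsHomogeneous d) ∧
    (∀ P ∈ complexLine l, ∃ k, aeval P.rep (A k) ≠ 0) ∧
    Z = {p | p.2 ∈ complexLine l ∧
      p.1.rep 0 * aeval p.2.rep (A 1) = p.1.rep 1 * aeval p.2.rep (A 0)}

/-- The line `l` splits on `W`: its preimage in `W` under the second projection is the union of two
distinct curves defined over `ℝ`, each mapped isomorphically onto the line. -/
def SplitsOn (Q₁ Q₂ Q₃ : MvPolynomial (Fin 3) ℝ) (l : Fin 3 → ℝ) : Prop :=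
  ∃ Z₁ Z₂, IsRealLineOver l Z₁ ∧ IsRealLineOver l Z₂ ∧ Z₁ ≠ Z₂ ∧
    delPezzo Q₁ Q₂ Q₃ ∩ Prod.snd ⁻¹' complexLine l = Z₁ ∪ Z₂

end RealQuartic

end

noncomputable section

open MvPolynomial
open scoped LinearAlgebra.Projectivization

namespace RealQuartic

open Set Filter Topology

/-!
Write `F = Q₁ Q₃ - Q₂²`, and represent an orientation of an open set `U ⊆ ℙ²(ℝ)` by an odd, locally
constant sign on the cone over `U`.

Some component of the complement of the ovals is non-orientable: otherwise the odd sign on the cone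
over the complement could be corrected along the ovals, where its jumps are constant, to one on
`ℝ³ ∖ {0}`, which is connected. This component is not contained in the complement of a line, which
is orientable, so it meets every line and singles out the outside of each oval. By Bézout a line
meets the insides of at most two ovals. Hence the insides are pairwise disjoint and orientable, the
common outside is connected, and `F` has one sign on it and the other sign on the insides.

Suppose that `F > 0` on the common outside. There the conics `q_t = t₀² Q₁ + 2 t₀ t₁ Q₂ + t₁² Q₃`
are definite forms in `t`; after a change of sign they are positive, so `{q_t < 0}` is contained in
the insides. For fixed `t` this set is, up to sign, convex, so it is contained in one inside, and
it is nonempty only if the determinant of `q_t`, a binary form of degree `6` in `t`, is negative.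
Each inside gives an arc of such `t` between two of the six zeros, and the arcs are pairwise
disjoint, so there are at most three.

Therefore `F < 0` at some point of every line. On a bitangent, `F` is up to sign the square of a
real form, so `F = -r²` and `Q₁ Q₃ = (Q₂ + r) (Q₂ - r)`. Unique factorization on the line then
splits `q_t` into two factors that are linear in `t`.
-/

/-! ### Topology of the real projective plane -/

/-- The projection `ℝ³ ∖ {0} → ℙ²(ℝ)`, made total by a junk value at the origin. -/
def pr (v : Fin 3 → ℝ) : RP2 :=
  open Classical in if hv : v ≠ 0 then Projectivization.mk ℝ v hv else Classical.arbitrary RP2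

lemma pr_of_ne_zero {v : Fin 3 → ℝ} (hv : v ≠ 0) : pr v = Projectivization.mk ℝ v hv := dif_pos hv

@[simp] lemma pr_rep (P : RP2) : pr P.rep = P := by
  rw [pr_of_ne_zero P.rep_nonzero, Projectivization.mk_rep]

lemma exists_pr_eq (P : RP2) : ∃ v, v ≠ 0 ∧ pr v = P := ⟨P.rep, P.rep_nonzero, pr_rep P⟩

lemma pr_smul {c : ℝ} (hc : c ≠ 0) (v : Fin 3 → ℝ) : pr (c • v) = pr v := by
  by_cases hv : v = 0
  · simp [hv]
  · rw [pr_of_ne_zero hv, pr_of_ne_zero (smul_ne_zero hc hv), Projectivization.mk_eq_mk_iff']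
    exact ⟨c, rfl⟩

lemma exists_smul_of_pr_eq {v w : Fin 3 → ℝ} (hv : v ≠ 0) (hw : w ≠ 0) (h : pr v = pr w) :
    ∃ c : ℝ, c ≠ 0 ∧ w = c • v := by
  rw [pr_of_ne_zero hv, pr_of_ne_zero hw, eq_comm, Projectivization.mk_eq_mk_iff'] at h
  obtain ⟨c, rfl⟩ := h
  exact ⟨c, left_ne_zero_of_smul hw, rfl⟩

lemma exists_rep_pr {v : Fin 3 → ℝ} (hv : v ≠ 0) : ∃ c : ℝ, c ≠ 0 ∧ (pr v).rep = c • v :=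
  exists_smul_of_pr_eq hv (pr v).rep_nonzero (by simp)

lemma isQuotientMap_pr : IsQuotientMap fun v : {v : Fin 3 → ℝ // v ≠ 0} => pr v := by
  have h : (fun v : {v : Fin 3 → ℝ // v ≠ 0} => pr v) = fun v => Projectivization.mk ℝ v.1 v.2 :=
    funext fun v => pr_of_ne_zero v.2
  exact h ▸ isQuotientMap_quot_mk

lemma continuousOn_pr : ContinuousOn pr {v | v ≠ 0} :=
  continuousOn_iff_continuous_domRestrict.2 isQuotientMap_pr.continuous

lemma continuousAt_pr {v : Fin 3 → ℝ} (hv : v ≠ 0) : ContinuousAt pr v :=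
  continuousOn_pr.continuousAt (isOpen_ne.mem_nhds hv)

lemma isOpen_image_pr {W : Set (Fin 3 → ℝ)} (hW : IsOpen W) (h0 : (0 : Fin 3 → ℝ) ∉ W) :
    IsOpen (pr '' W) := by
  have hsat : (fun v : {v : Fin 3 → ℝ // v ≠ 0} => pr v) ⁻¹' (pr '' W) =
      ⋃ c : {c : ℝ // c ≠ 0}, {v | c.1 • v.1 ∈ W} := by
    ext ⟨v, hv⟩
    simp only [mem_preimage, mem_image, mem_iUnion, mem_ofPred_eq]
    constructor
    · rintro ⟨w, hw, h⟩
      obtain ⟨c, hc, rfl⟩ := exists_smul_of_pr_eq hv (ne_of_mem_of_not_mem hw h0) h.symm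
      exact ⟨⟨c, hc⟩, hw⟩
    · rintro ⟨⟨c, hc⟩, h⟩
      exact ⟨_, h, pr_smul hc v⟩
  rw [← isQuotientMap_pr.isOpen_preimage, hsat]
  exact isOpen_iUnion fun c => hW.preimage (by fun_prop)

lemma map_pr_nhds {v : Fin 3 → ℝ} (hv : v ≠ 0) : map pr (𝓝 v) = 𝓝 (pr v) := by
  refine le_antisymm (continuousAt_pr hv) fun s hs => ?_
  obtain ⟨W, hWs, hW, hvW⟩ := mem_nhds_iff.1 (inter_mem (mem_map.1 hs) (isOpen_ne.mem_nhds hv))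
  refine mem_of_superset ((isOpen_image_pr hW fun h => (hWs h).2 rfl).mem_nhds ⟨v, hvW, rfl⟩) ?_
  exact image_subset_iff.2 fun w hw => (hWs hw).1

lemma eventually_nhds_pr {v : Fin 3 → ℝ} (hv : v ≠ 0) {p : RP2 → Prop} :
    (∀ᶠ P in 𝓝 (pr v), p P) ↔ ∀ᶠ w in 𝓝 v, p (pr w) := by
  rw [← map_pr_nhds hv, eventually_map]

lemma eventually_pr_mem {v : Fin 3 → ℝ} (hv : v ≠ 0) {U : Set RP2} (hU : IsOpen U)
    (hvU : pr v ∈ U) : ∀ᶠ x in 𝓝 v, pr x ∈ U :=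
  (continuousAt_pr hv).eventually (hU.mem_nhds hvU)

lemma isConnected_ne_zero : IsConnected {v : Fin 3 → ℝ | v ≠ 0} :=
  isConnected_compl_singleton_of_one_lt_rank (by simp) 0

instance : PreconnectedSpace RP2 := by
  have : PreconnectedSpace {v : Fin 3 → ℝ // v ≠ 0} :=
    Subtype.preconnectedSpace isConnected_ne_zero.isPreconnected
  exact isQuotientMap_pr.surjective.denseRange.preconnectedSpace isQuotientMap_pr.continuous

instance : LocallyConnectedSpace RP2 :=
  have : LocallyConnectedSpace {v : Fin 3 → ℝ // v ≠ 0} := isOpen_ne.locallyConnectedSpace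
  isQuotientMap_pr.isCoinducing.locallyConnectedSpace

/-- The embedding of the projective plane in the space of matrices by `x_i x_j / |x|²`, which
shows that the projective plane is a Hausdorff space. -/
def veronese (P : RP2) (i j : Fin 3) : ℝ := P.rep i * P.rep j / ∑ k, P.rep k ^ 2

lemma sum_sq_pos {v : Fin 3 → ℝ} (hv : v ≠ 0) : 0 < ∑ k, v k ^ 2 := by
  obtain ⟨i, hi⟩ := Function.ne_iff.1 hv
  exact Finset.sum_pos' (fun _ _ => sq_nonneg _) ⟨i, Finset.mem_univ _, sq_pos_of_ne_zero hi⟩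

lemma veronese_pr {v : Fin 3 → ℝ} (hv : v ≠ 0) (i j : Fin 3) :
    veronese (pr v) i j = v i * v j / ∑ k, v k ^ 2 := by
  obtain ⟨c, hc, h⟩ := exists_rep_pr hv
  simp only [veronese, h, Pi.smul_apply, smul_eq_mul, mul_pow, ← Finset.mul_sum]
  have := (sum_sq_pos hv).ne'
  field_simp

lemma continuous_veronese : Continuous veronese := by
  have h (k) : Continuous fun v : {v : Fin 3 → ℝ // v ≠ 0} => v.1 k :=
    (continuous_apply k).comp continuous_subtype_val
  refine continuous_pi fun i => continuous_pi fun j => isQuotientMap_pr.continuous_iff.2 <|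
    Continuous.congr (((h i).mul (h j)).div (continuous_finsetSum _ fun k _ => (h k).pow 2)
      fun v => (sum_sq_pos v.2).ne') fun v => (veronese_pr v.2 i j).symm

lemma veronese_injective : Function.Injective veronese := by
  intro P Q h
  obtain ⟨i, hi⟩ := Function.ne_iff.1 P.rep_nonzero
  have ha := sum_sq_pos P.rep_nonzero
  have hb := sum_sq_pos Q.rep_nonzero
  have key (j) := congrFun (congrFun h i) j
  simp only [veronese, div_eq_div_iff ha.ne' hb.ne'] at key
  have hPQ : (P.rep i * ∑ k, Q.rep k ^ 2) • P.rep = (Q.rep i * ∑ k, P.rep k ^ 2) • Q.rep := by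
    ext j
    simp only [Pi.smul_apply, smul_eq_mul]
    linarith [key j]
  have hP : P.rep i * ∑ k, Q.rep k ^ 2 ≠ 0 := mul_ne_zero hi hb.ne'
  have hQ : Q.rep i * ∑ k, P.rep k ^ 2 ≠ 0 := fun h0 =>
    smul_ne_zero hP P.rep_nonzero (by rw [hPQ, h0, zero_smul])
  rw [← pr_rep P, ← pr_smul hP, hPQ, pr_smul hQ, pr_rep]

instance : T2Space RP2 := .of_injective_continuous veronese_injective continuous_veronese

/-! ### Orientations as odd signs -/

lemma hasFDerivAt_insertNth (i m : Fin 3) (c : ℝ) (y : Fin 2 → ℝ) :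
    HasFDerivAt (fun z : Fin 2 → ℝ => (i.insertNth c z : Fin 3 → ℝ) m)
      ((i.insertNth 0 ContinuousLinearMap.proj : Fin 3 → (Fin 2 → ℝ) →L[ℝ] ℝ) m) y := by
  cases m using i.succAboveCases with
  | x => simpa using hasFDerivAt_const c y
  | p k => simpa using hasFDerivAt_apply k y

lemma hasFDerivAt_transition (i j : Fin 3) {x : Fin 3 → ℝ} (hi : x i = 1) (hj : x j ≠ 0) :
    HasFDerivAt (transition i j)
      (ContinuousLinearMap.pi fun k =>
        let dx : Fin 3 → (Fin 2 → ℝ) →L[ℝ] ℝ := i.insertNth 0 ContinuousLinearMap.proj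
        (x j)⁻¹ • dx (j.succAbove k) - (x (j.succAbove k) / x j ^ 2) • dx j)
      (i.removeNth x) := by
  have hx : i.insertNth 1 (i.removeNth x) = x := by rw [← hi, Fin.insertNth_self_removeNth]
  refine hasFDerivAt_pi.2 fun k => ?_
  have hden := hasFDerivAt_insertNth i j 1 (i.removeNth x)
  have hinv := (hasDerivAt_inv hj).comp_hasFDerivAt_of_eq (i.removeNth x) hden (by rw [hx])
  refine ((hasFDerivAt_insertNth i (j.succAbove k) 1 _).mul hinv).congr_fderiv ?_
  ext z
  simp only [hx, neg_smul, smul_neg, Function.comp_apply, add_apply, neg_apply, smul_apply,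
    smul_eq_mul, sub_apply]
  ring

lemma det_fderiv_transition (i j : Fin 3) {x : Fin 3 → ℝ} (hi : x i = 1) (hj : x j ≠ 0) :
    (fderiv ℝ (transition i j) (i.removeNth x)).det =
      (-1) ^ (i : ℕ) * (-1) ^ (j : ℕ) / x j ^ 3 := by
  rw [(hasFDerivAt_transition i j hi hj).fderiv, ContinuousLinearMap.det,
    ← LinearMap.det_toMatrix', Matrix.det_fin_two]
  fin_cases i <;> fin_cases j <;>
    simp_all [LinearMap.toMatrix'_apply, Fin.insertNth, Fin.succAboveCases, Fin.succAbove] <;>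
    field_simp

/-- The sign of a real number as a unit of `ℤ`, with the junk value `-1` at `0`. -/
def unitSign (x : ℝ) : ℤˣ := open Classical in if 0 < x then 1 else -1

lemma unitSign_of_pos {x : ℝ} (h : 0 < x) : unitSign x = 1 := if_pos h

lemma unitSign_of_neg {x : ℝ} (h : x < 0) : unitSign x = -1 := if_neg h.not_gt

lemma unitSign_mul_abs (x : ℝ) : (unitSign x : ℤ) * |x| = x := by
  rcases lt_or_ge 0 x with h | h
  · simp [unitSign_of_pos h, abs_of_pos h]
  · simp [unitSign, h.not_gt, abs_of_nonpos h]

lemma unitSign_mul {c x : ℝ} (hc : c ≠ 0) (hx : x ≠ 0) :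
    unitSign (c * x) = unitSign c * unitSign x := by
  rcases hc.lt_or_gt with hc | hc <;> rcases hx.lt_or_gt with hx | hx <;>
    simp [unitSign_of_pos, unitSign_of_neg, mul_neg_of_neg_of_pos, mul_neg_of_pos_of_neg,
      mul_pos_of_neg_of_neg, hc, hx]

lemma eventually_unitSign_eq {Y : Type*} [TopologicalSpace Y] {g : Y → ℝ} {y : Y}
    (hg : ContinuousAt g y) (h : g y ≠ 0) : ∀ᶠ z in 𝓝 y, unitSign (g z) = unitSign (g y) := by
  rcases h.lt_or_gt with h | h
  · filter_upwards [hg.eventually_lt_const h] with z hz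
    rw [unitSign_of_neg hz, unitSign_of_neg h]
  · filter_upwards [hg.eventually_const_lt h] with z hz
    rw [unitSign_of_pos hz, unitSign_of_pos h]

lemma units_mul_pos_iff (u v : ℤˣ) : 0 < ((u : ℤ) : ℝ) * (v : ℤ) ↔ u = v := by
  rcases Int.units_eq_one_or u with rfl | rfl <;> rcases Int.units_eq_one_or v with rfl | rfl <;>
    norm_num

lemma unitSign_neg_one_pow_mul_mul (n : ℕ) {c x : ℝ} (hc : c ≠ 0) (hx : x ≠ 0) :
    unitSign ((-1) ^ n * (c * x)) = unitSign c * unitSign ((-1) ^ n * x) := by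
  rw [mul_left_comm, unitSign_mul hc (by simp [hx])]

lemma jacobian_pos_iff (i j : Fin 3) (P : RP2) (hi : P.rep i ≠ 0) (hj : P.rep j ≠ 0) (a b : ℤˣ) :
    0 < ((a : ℤ) : ℝ) * ((b : ℤ) : ℝ) * (fderiv ℝ (transition i j) (chart i P)).det ↔
      a * unitSign ((-1) ^ (i : ℕ) * P.rep i) = b * unitSign ((-1) ^ (j : ℕ) * P.rep j) := by
  have hchart : chart i P = i.removeNth ((P.rep i)⁻¹ • P.rep) := by
    ext k
    simp [chart, Fin.removeNth, div_eq_inv_mul]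
  rw [hchart, det_fderiv_transition i j (by simp [hi]) (by simp [hi, hj]), ← units_mul_pos_iff]
  have hx := unitSign_mul_abs ((-1) ^ (i : ℕ) * P.rep i)
  have hy := unitSign_mul_abs ((-1) ^ (j : ℕ) * P.rep j)
  set u := unitSign ((-1) ^ (i : ℕ) * P.rep i)
  set v := unitSign ((-1) ^ (j : ℕ) * P.rep j)
  have key : (a : ℤ) * (b : ℤ) *
      ((-1) ^ (i : ℕ) * (-1) ^ (j : ℕ) / ((P.rep i)⁻¹ • P.rep) j ^ 3) =
      ((a * u : ℤˣ) : ℤ) * ((b * v : ℤˣ) : ℤ) *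
        (|P.rep i| * |P.rep j| * (P.rep i ^ 2 / P.rep j ^ 4)) := by
    calc _ = ((a : ℤ) : ℝ) * (b : ℤ) * ((-1) ^ (i : ℕ) * P.rep i) * ((-1) ^ (j : ℕ) * P.rep j) *
          (P.rep i ^ 2 / P.rep j ^ 4) := by
          simp only [Pi.smul_apply, smul_eq_mul]
          field_simp
      _ = _ := by
          rw [← hx, ← hy]
          simp only [abs_mul, abs_pow, abs_neg, abs_one, one_pow, one_mul, Units.val_mul]
          push_cast
          ring
  rw [key, mul_pos_iff_of_pos_right (by positivity)]

/-- The sign `s` is odd and locally constant on the cone over `S ⊆ ℙ²(ℝ)`; for open `S`, such a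
sign is an orientation of `S`. -/
structure IsOddSignOn (S : Set RP2) (s : (Fin 3 → ℝ) → ℤˣ) : Prop where
  map_smul : ∀ v, v ≠ 0 → pr v ∈ S → ∀ c : ℝ, c ≠ 0 → s (c • v) = unitSign c * s v
  eventually_eq : ∀ v, v ≠ 0 → pr v ∈ S → ∀ᶠ x in 𝓝 v, s x = s v

lemma IsOddSignOn.mono {S T : Set RP2} {s : (Fin 3 → ℝ) → ℤˣ} (h : IsOddSignOn T s) (hST : S ⊆ T) :
    IsOddSignOn S s :=
  ⟨fun v hv hS => h.map_smul v hv (hST hS), fun v hv hS => h.eventually_eq v hv (hST hS)⟩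

lemma IsOddSignOn.map_neg {S : Set RP2} {s : (Fin 3 → ℝ) → ℤˣ} (h : IsOddSignOn S s)
    {v : Fin 3 → ℝ} (hv : v ≠ 0) (hS : pr v ∈ S) : s (-v) = -s v := by
  simpa [unitSign_of_neg neg_one_lt_zero] using h.map_smul v hv hS (-1) (by norm_num)

lemma eventually_coord_ne_zero {v : Fin 3 → ℝ} {i : Fin 3} (hi : v i ≠ 0) :
    ∀ᶠ x : Fin 3 → ℝ in 𝓝 v, x i ≠ 0 :=
  (continuousAt_apply i v).eventually_ne hi

lemma isOpen_chartDomain (i : Fin 3) : IsOpen (chartDomain i) := by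
  refine isOpen_iff_mem_nhds.2 fun P hP => ?_
  rw [← pr_rep P]
  refine (eventually_nhds_pr P.rep_nonzero).2 ?_
  filter_upwards [eventually_coord_ne_zero hP] with x hx
  obtain ⟨c, hc, h⟩ := exists_rep_pr (v := x) fun h => hx (by simp [h])
  simpa [chartDomain, h, hc] using hx

/-- The sign by which an odd sign corrects the `i`-th affine chart. -/
def chartSign (s : (Fin 3 → ℝ) → ℤˣ) (i : Fin 3) (P : RP2) : ℤˣ :=
  unitSign ((-1) ^ (i : ℕ) * P.rep i) * s P.rep

lemma chartSign_pr {S : Set RP2} {s : (Fin 3 → ℝ) → ℤˣ} (hs : IsOddSignOn S s) {i : Fin 3}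
    {v : Fin 3 → ℝ} (hi : v i ≠ 0) (hS : pr v ∈ S) :
    chartSign s i (pr v) = unitSign ((-1) ^ (i : ℕ) * v i) * s v := by
  have hv : v ≠ 0 := fun h => hi (by simp [h])
  obtain ⟨c, hc, h⟩ := exists_rep_pr hv
  rw [chartSign, h, hs.map_smul v hv hS c hc, Pi.smul_apply, smul_eq_mul,
    unitSign_neg_one_pow_mul_mul _ hc hi, mul_mul_mul_comm, Int.units_mul_self, one_mul]

lemma eventually_unitSign_coord_eq {v : Fin 3 → ℝ} {i : Fin 3} (hi : v i ≠ 0) :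
    ∀ᶠ x : Fin 3 → ℝ in 𝓝 v,
      unitSign ((-1) ^ (i : ℕ) * x i) = unitSign ((-1) ^ (i : ℕ) * v i) :=
  eventually_unitSign_eq (g := fun x : Fin 3 → ℝ => (-1) ^ (i : ℕ) * x i)
    (continuous_const.mul (continuous_apply i)).continuousAt (by simp [hi])

lemma IsOddSignOn.isOrientable {S : Set RP2} {s : (Fin 3 → ℝ) → ℤˣ} (hs : IsOddSignOn S s) :
    IsOrientable S := by
  refine ⟨chartSign s, fun i P hP => ?_, ?_⟩
  · have hconst : ∀ᶠ Q in 𝓝 P, Q ∈ S ∩ chartDomain i → chartSign s i P = chartSign s i Q := by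
      rw [← pr_rep P, eventually_nhds_pr P.rep_nonzero]
      filter_upwards [eventually_unitSign_coord_eq hP.2, eventually_coord_ne_zero hP.2,
        hs.eventually_eq _ P.rep_nonzero (by simpa using hP.1)] with x h1 h2 h3 hx
      rw [chartSign_pr hs hP.2 (by simpa using hP.1), chartSign_pr hs h2 hx.1, h1, h3]
    exact tendsto_const_nhds.congr' (eventually_nhdsWithin_iff.2 hconst)
  · rintro i j P ⟨⟨-, hi⟩, hj⟩
    rw [jacobian_pos_iff i j P hi hj, chartSign, chartSign, mul_comm (unitSign _),
      mul_comm (unitSign _), mul_assoc, mul_assoc, Int.units_mul_self, Int.units_mul_self]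

lemma isOddSignOn_dotProduct (l : Fin 3 → ℝ) :
    IsOddSignOn {P | l ⬝ᵥ P.rep ≠ 0} fun v => unitSign (l ⬝ᵥ v) := by
  have hne (v) (hv : v ≠ 0) (hl : l ⬝ᵥ (pr v).rep ≠ 0) : l ⬝ᵥ v ≠ 0 := by
    obtain ⟨c, -, h⟩ := exists_rep_pr hv
    rw [h, dotProduct_smul] at hl
    exact right_ne_zero_of_smul hl
  refine ⟨fun v hv hl c hc => ?_, fun v hv hl => eventually_unitSign_eq ?_ (hne v hv hl)⟩
  · rw [dotProduct_smul, smul_eq_mul, unitSign_mul hc (hne v hv hl)]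
  · exact (Continuous.dotProduct continuous_const continuous_id).continuousAt

lemma isOrientable_of_forall_ne_zero {U : Set RP2} (l : Fin 3 → ℝ)
    (hU : ∀ P ∈ U, l ⬝ᵥ P.rep ≠ 0) : IsOrientable U :=
  ((isOddSignOn_dotProduct l).mono hU).isOrientable

lemma IsOrientable.exists_isOddSignOn {U : Set RP2} (hU : IsOrientable U) (hUo : IsOpen U) :
    ∃ s, IsOddSignOn U s := by
  obtain ⟨ε, hε, hpos⟩ := hU
  choose! idx hidx using fun (v : Fin 3 → ℝ) (hv : v ≠ 0) => Function.ne_iff.1 hv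
  let s (i : Fin 3) (v : Fin 3 → ℝ) : ℤˣ := ε i (pr v) * unitSign ((-1) ^ (i : ℕ) * v i)
  have hsmul {i : Fin 3} {v : Fin 3 → ℝ} (hi : v i ≠ 0) {c : ℝ} (hc : c ≠ 0) :
      s i (c • v) = unitSign c * s i v := by
    simp only [s, pr_smul hc, Pi.smul_apply, smul_eq_mul, unitSign_neg_one_pow_mul_mul _ hc hi]
    rw [mul_left_comm]
  have heq {v : Fin 3 → ℝ} (hv : v ≠ 0) (hvU : pr v ∈ U) {i j : Fin 3} (hi : v i ≠ 0)
      (hj : v j ≠ 0) : s i v = s j v := by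
    obtain ⟨c, hc, h⟩ := exists_rep_pr hv
    have hrep (k) (hk : v k ≠ 0) : (pr v).rep k ≠ 0 := by simp [h, hc, hk]
    have := (jacobian_pos_iff i j _ (hrep i hi) (hrep j hj) _ _).1
      (hpos i j _ ⟨⟨hvU, hrep i hi⟩, hrep j hj⟩)
    rw [h, ← pr_smul hc v] at this
    exact mul_left_cancel (((hsmul hi hc).symm.trans this).trans (hsmul hj hc))
  refine ⟨fun v => s (idx v) v, fun v hv hvU c hc => ?_, fun v hv hvU => ?_⟩
  · have hcv := smul_ne_zero hc hv
    have hi : (c • v) (idx v) ≠ 0 := mul_ne_zero hc (hidx v hv)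
    exact (heq hcv (by rwa [pr_smul hc]) (hidx _ hcv) hi).trans (hsmul (hidx v hv) hc)
  · have hi : v (idx v) ≠ 0 := hidx v hv
    have hdom : pr v ∈ chartDomain (idx v) := by
      obtain ⟨c, hc, h⟩ := exists_rep_pr hv
      simpa [chartDomain, h, hc] using hi
    have hε' : ∀ᶠ x in 𝓝 v, ε (idx v) (pr x) = ε (idx v) (pr v) :=
      (eventually_nhds_pr hv).1 <| ((hε _).continuousAt <|
        (hUo.inter (isOpen_chartDomain _)).mem_nhds ⟨hvU, hdom⟩).eventually_mem
          ((isOpen_discrete {ε (idx v) (pr v)}).mem_nhds rfl)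
    filter_upwards [hε', eventually_unitSign_coord_eq hi, eventually_coord_ne_zero hi,
      eventually_pr_mem hv hUo hvU, isOpen_ne.mem_nhds hv] with x h1 h2 h3 h4 h5
    rw [heq h5 h4 (hidx x h5) h3]
    simp only [s, h1, h2]

/-! ### Real forms of even degree -/

lemma aeval_smul_of_isHomogeneous {σ R A : Type*} [CommSemiring R] [CommSemiring A] [Algebra R A]
    {Q : MvPolynomial σ R} {n : ℕ} (hQ : Q.IsHomogeneous n) (c : A) (v : σ → A) :
    aeval (c • v) Q = c ^ n * aeval v Q := by
  simp only [aeval_def, eval₂_eq, Finset.mul_sum]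
  refine Finset.sum_congr rfl fun d hd => ?_
  have hd' : ∑ i ∈ d.support, d i = n := by
    rw [← Finsupp.degree_apply]
    exact of_not_not fun h => mem_support_iff.1 hd (hQ.coeff_eq_zero h)
  simp only [Pi.smul_apply, smul_eq_mul, mul_pow, Finset.prod_mul_distrib,
    Finset.prod_pow_eq_pow_sum, hd']
  ring

lemma eval_smul_of_isHomogeneous {σ R : Type*} [CommSemiring R] {Q : MvPolynomial σ R} {n : ℕ}
    (hQ : Q.IsHomogeneous n) (c : R) (v : σ → R) : eval (c • v) Q = c ^ n * eval v Q := by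
  simpa [coe_aeval_eq_eval] using aeval_smul_of_isHomogeneous hQ c v

/-- The set `(F > 0)_ℝ` of real points at which the form `F` is positive. -/
def posLocus (F : MvPolynomial (Fin 3) ℝ) : Set RP2 := {P | 0 < eval P.rep F}

lemma negLocus_neg (F : MvPolynomial (Fin 3) ℝ) : negLocus (-F) = posLocus F := by
  simp [posLocus, negLocus]

lemma compl_zeroLocus (F : MvPolynomial (Fin 3) ℝ) : (zeroLocus F)ᶜ = posLocus F ∪ negLocus F := by
  ext P
  exact ne_iff_lt_or_gt.trans or_comm

lemma disjoint_posLocus_negLocus (F : MvPolynomial (Fin 3) ℝ) :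
    Disjoint (posLocus F) (negLocus F) :=
  disjoint_left.2 fun P (hp : 0 < eval P.rep F) (hn : eval P.rep F < 0) => lt_asymm hp hn

section EvenForm

variable {F : MvPolynomial (Fin 3) ℝ} {n : ℕ} {v : Fin 3 → ℝ}

lemma exists_eval_rep_pr (hF : F.IsHomogeneous n) (hn : Even n) (hv : v ≠ 0) :
    ∃ c : ℝ, 0 < c ∧ eval (pr v).rep F = c * eval v F := by
  obtain ⟨c, hc, h⟩ := exists_rep_pr hv
  exact ⟨c ^ n, hn.pow_pos hc, by rw [h, eval_smul_of_isHomogeneous hF]⟩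

lemma pr_mem_zeroLocus (hF : F.IsHomogeneous n) (hn : Even n) (hv : v ≠ 0) :
    pr v ∈ zeroLocus F ↔ eval v F = 0 := by
  obtain ⟨c, hc, h⟩ := exists_eval_rep_pr hF hn hv
  simp [zeroLocus, h, hc.ne']

lemma pr_mem_posLocus (hF : F.IsHomogeneous n) (hn : Even n) (hv : v ≠ 0) :
    pr v ∈ posLocus F ↔ 0 < eval v F := by
  obtain ⟨c, hc, h⟩ := exists_eval_rep_pr hF hn hv
  simp [posLocus, h, hc]

lemma pr_mem_negLocus (hF : F.IsHomogeneous n) (hn : Even n) (hv : v ≠ 0) :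
    pr v ∈ negLocus F ↔ eval v F < 0 := by
  obtain ⟨c, hc, h⟩ := exists_eval_rep_pr hF hn hv
  simp [negLocus, h, mul_neg_iff, hc, hc.not_gt]

lemma isOpen_posLocus (hF : F.IsHomogeneous n) (hn : Even n) : IsOpen (posLocus F) := by
  refine isOpen_iff_mem_nhds.2 fun P hP => ?_
  obtain ⟨v, hv, rfl⟩ := exists_pr_eq P
  rw [pr_mem_posLocus hF hn hv] at hP
  refine (eventually_nhds_pr hv).2 ?_
  filter_upwards [(continuous_eval F).continuousAt.eventually (lt_mem_nhds hP),
    isOpen_ne.mem_nhds hv] with w hw hw0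
  exact (pr_mem_posLocus hF hn hw0).2 hw

lemma isOpen_negLocus (hF : F.IsHomogeneous n) (hn : Even n) : IsOpen (negLocus F) := by
  simpa [← negLocus_neg] using isOpen_posLocus hF.neg hn

end EvenForm

/-! ### The two sides of a smooth curve -/

/-- The set `H` has a single local branch at `c`: arbitrarily small neighbourhoods of `c` meet `H`
in a connected set. The two local sides of a smooth curve are of this kind. -/
def IsSideAt {X : Type*} [TopologicalSpace X] (H : Set X) (c : X) : Prop :=
  ∀ V ∈ 𝓝 c, ∃ W ∈ 𝓝 c, W ⊆ V ∧ IsConnected (W ∩ H)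

lemma IsSideAt.frequently {X : Type*} [TopologicalSpace X] {H : Set X} {c : X}
    (h : IsSideAt H c) : ∃ᶠ x in 𝓝 c, x ∈ H := by
  refine frequently_iff.2 fun hV => ?_
  obtain ⟨W, -, hWV, ⟨x, hx⟩, -⟩ := h _ hV
  exact ⟨x, hWV hx.1, hx.2⟩

lemma IsSideAt.image {X Y : Type*} [TopologicalSpace X] [TopologicalSpace Y] {f : X → Y} {x : X}
    {S K : Set X} {H : Set Y} (h : IsSideAt K x) (hf : ContinuousOn f S) (hS : S ∈ 𝓝 x)
    (hx : map f (𝓝 x) = 𝓝 (f x)) (hKH : ∀ w ∈ S, f w ∈ H ↔ w ∈ K) : IsSideAt H (f x) := by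
  intro V hV
  rw [← hx, mem_map] at hV
  obtain ⟨W, hW, hWV, hc⟩ := h _ (inter_mem hV hS)
  have himage : f '' W ∩ H = f '' (W ∩ K) := by
    rw [← image_inter_preimage]
    exact congrArg _ (Set.ext fun w => and_congr_right fun hw => hKH w (hWV hw).2)
  refine ⟨f '' W, hx ▸ image_mem_map hW, image_subset_iff.2 fun w hw => (hWV hw).1, ?_⟩
  exact himage ▸ hc.image _ (hf.mono fun w hw => (hWV hw.1).2)

lemma isSideAt_fst_pos (E : Type*) [SeminormedAddCommGroup E] [NormedSpace ℝ E] :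
    IsSideAt {z : ℝ × E | 0 < z.1} (0, 0) := by
  intro V hV
  obtain ⟨r, hr, hrV⟩ := Metric.mem_nhds_iff.1 hV
  refine ⟨Metric.ball (0, 0) r, Metric.ball_mem_nhds _ hr, hrV, ⟨(r / 2, 0), ?_, ?_⟩, ?_⟩
  · simp [abs_of_pos hr, hr]
  · simpa using hr
  · exact ((convex_ball _ _).inter (convex_halfSpace_gt (f := fun z : ℝ × E => z.1)
      ⟨fun _ _ => rfl, fun _ _ => rfl⟩ 0)).isPreconnected

lemma isSideAt_pos_of_hasStrictFDerivAt {E : Type*} [NormedAddCommGroup E] [NormedSpace ℝ E]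
    [CompleteSpace E] {f : E → ℝ} {f' : E →L[ℝ] ℝ} {a : E} (hf : HasStrictFDerivAt f f' a)
    (hf' : f' ≠ 0) (ha : f a = 0) : IsSideAt {x | 0 < f x} a := by
  have hr : f'.range = ⊤ := LinearMap.range_eq_top.2 (LinearMap.surjective fun h0 =>
    hf' (ContinuousLinearMap.coe_injective h0))
  set e := hf.implicitToOpenPartialHomeomorph f f' hr
  have hea : e a = (0, 0) := by rw [hf.implicitToOpenPartialHomeomorph_self hr, ha]
  have hes : a ∈ e.source := hf.mem_implicitToOpenPartialHomeomorph_source hr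
  have het : e a ∈ e.target := e.map_source hes
  have hfe : ∀ z ∈ e.target, f (e.symm z) = z.1 := fun z hz => congrArg Prod.fst (e.right_inv hz)
  have hside := IsSideAt.image (H := {x | 0 < f x}) (hea ▸ isSideAt_fst_pos f'.ker)
    e.continuousOn_symm (e.open_target.mem_nhds het) (e.symm.map_nhds_eq het)
    fun z hz => by simp [hfe z hz]
  rwa [e.left_inv hes] at hside

lemma hasStrictFDerivAt_eval {σ : Type*} [Fintype σ] (F : MvPolynomial σ ℝ) (v : σ → ℝ) :
    HasStrictFDerivAt (fun w => eval w F)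
      (∑ i, eval v (pderiv i F) • ContinuousLinearMap.proj (R := ℝ) (φ := fun _ : σ => ℝ) i) v := by
  classical
  induction F using MvPolynomial.induction_on with
  | C a => simpa using hasStrictFDerivAt_const a v
  | add p q hp hq => simpa [add_smul, Finset.sum_add_distrib] using hp.fun_add hq
  | mul_X p j hp =>
    have hX : HasStrictFDerivAt (fun w : σ → ℝ => w j)
      (ContinuousLinearMap.proj (R := ℝ) (φ := fun _ : σ => ℝ) j) v := hasStrictFDerivAt_apply j v
    simpa [pderiv_X, Pi.single_apply, apply_ite (eval v), ite_smul, add_smul, mul_smul,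
      Finset.sum_add_distrib, Finset.smul_sum] using hp.fun_mul hX

section SmoothCurve

variable {F : MvPolynomial (Fin 3) ℝ} {n : ℕ}

lemma IsSmoothCurve.exists_pderiv_ne_zero (hs : IsSmoothCurve F) {v : Fin 3 → ℝ} (hv : v ≠ 0)
    (h : eval v F = 0) : ∃ i, eval v (pderiv i F) ≠ 0 := by
  have aeval_coe (G : MvPolynomial (Fin 3) ℝ) :
      aeval (fun i => (v i : ℂ)) G = (eval v G : ℂ) := by
    simpa [coe_aeval_eq_eval, Function.comp_def] using aeval_algebraMap_apply ℂ v G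
  obtain ⟨i, hi⟩ := hs (fun i => (v i : ℂ)) (fun h0 => hv (by
    ext i; simpa using congrFun h0 i)) (by rw [aeval_coe, h, Complex.ofReal_zero])
  exact ⟨i, fun h0 => hi (by rw [aeval_coe, h0, Complex.ofReal_zero])⟩

lemma IsSmoothCurve.neg (hs : IsSmoothCurve F) : IsSmoothCurve (-F) := by
  intro v hv h
  obtain ⟨i, hi⟩ := hs v hv (by simpa using h)
  exact ⟨i, by simpa using hi⟩

lemma IsSmoothCurve.isSideAt_eval_pos (hs : IsSmoothCurve F) {v : Fin 3 → ℝ} (hv : v ≠ 0)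
    (h : eval v F = 0) : IsSideAt {w | 0 < eval w F} v := by
  obtain ⟨i, hi⟩ := hs.exists_pderiv_ne_zero hv h
  refine isSideAt_pos_of_hasStrictFDerivAt (hasStrictFDerivAt_eval F v) (fun h0 => hi ?_) h
  simpa [Pi.single_apply] using congr($h0 (Pi.single i 1))

lemma IsSmoothCurve.isSideAt_eval_neg (hs : IsSmoothCurve F) {v : Fin 3 → ℝ} (hv : v ≠ 0)
    (h : eval v F = 0) : IsSideAt {w | eval w F < 0} v := by
  simpa using hs.neg.isSideAt_eval_pos hv (by simpa using h)

lemma IsSmoothCurve.isSideAt_posLocus (hs : IsSmoothCurve F) (hF : F.IsHomogeneous n)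
    (hn : Even n) {P : RP2} (hP : P ∈ zeroLocus F) : IsSideAt (posLocus F) P := by
  obtain ⟨v, hv, rfl⟩ := exists_pr_eq P
  rw [pr_mem_zeroLocus hF hn hv] at hP
  exact (hs.isSideAt_eval_pos hv hP).image continuousOn_pr (isOpen_ne.mem_nhds hv)
    (map_pr_nhds hv) fun w hw => pr_mem_posLocus hF hn hw

lemma IsSmoothCurve.isSideAt_negLocus (hs : IsSmoothCurve F) (hF : F.IsHomogeneous n)
    (hn : Even n) {P : RP2} (hP : P ∈ zeroLocus F) : IsSideAt (negLocus F) P := by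
  simpa [← negLocus_neg] using hs.neg.isSideAt_posLocus hF.neg hn (P := P)
    (by simpa [zeroLocus] using hP)

end SmoothCurve

/-! ### Two-sided curves -/

section TwoSidedCurve

variable {X ι : Type*} [TopologicalSpace X]

lemma IsSideAt.congr {H K : Set X} {c : X} (h : IsSideAt H c)
    (hHK : ∀ᶠ x in 𝓝 c, x ∈ H ↔ x ∈ K) : IsSideAt K c := by
  intro V hV
  obtain ⟨W, hW, hWV, hc⟩ := h _ (inter_mem hV hHK)
  have hWHK : W ∩ H = W ∩ K := Set.ext fun x => and_congr_right fun hx => (hWV hx).2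
  exact ⟨W, hW, fun x hx => (hWV hx).1, hWHK ▸ hc⟩

/-- Along a connected set `K`, a side `H` lies in only one of two disjoint open sets. -/
lemma side_subset_or_subset {K H A B : Set X} (hK : IsPreconnected K)
    (hH : ∀ c ∈ K, IsSideAt H c) (hA : IsOpen A) (hB : IsOpen B) (hAB : Disjoint A B)
    (hcov : ∀ c ∈ K, ∀ᶠ x in 𝓝 c, x ∈ H → x ∈ A ∪ B) :
    (∀ c ∈ K, ∀ᶠ x in 𝓝 c, x ∈ H → x ∈ A) ∨ ∀ c ∈ K, ∀ᶠ x in 𝓝 c, x ∈ H → x ∈ B := by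
  have hcov' : K ⊆ {c | ∀ᶠ x in 𝓝 c, x ∈ H → x ∈ A} ∪ {c | ∀ᶠ x in 𝓝 c, x ∈ H → x ∈ B} := by
    intro c hc
    obtain ⟨W, hW, hWV, hWc⟩ := hH c hc _ (hcov c hc)
    exact (hWc.isPreconnected.subset_or_subset hA hB hAB fun x hx => hWV hx.1 hx.2).imp
      (fun h => mem_of_superset hW fun x hx hxH => h ⟨hx, hxH⟩)
      (fun h => mem_of_superset hW fun x hx hxH => h ⟨hx, hxH⟩)
  by_contra! ⟨⟨c, hcK, hcA⟩, d, hdK, hdB⟩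
  obtain ⟨x, hx, hxA, hxB⟩ := hK _ _ isOpen_setOfPred_eventually_nhds
    isOpen_setOfPred_eventually_nhds hcov'
    ⟨d, hdK, (hcov' hdK).resolve_right fun h => hdB <| h.mono (by tauto)⟩
    ⟨c, hcK, (hcov' hcK).resolve_left fun h => hcA <| h.mono (by tauto)⟩
  obtain ⟨y, hy, hyA, hyB⟩ := ((hH x hx).frequently.and_eventually
    (Filter.Eventually.and hxA hxB)).exists
  exact disjoint_left.1 hAB (hyA hy) (hyB hy)

/-- The curve `⋃ i, C i` is a disjoint union of closed connected sets, and its complement is the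
disjoint union of two open sets `P` and `N`, which are the two sides of the curve at each of its
points. For a smooth real plane curve `F = 0` of even degree these are `F > 0` and `F < 0`. -/
structure IsTwoSidedCurve (P N : Set X) (C : ι → Set X) : Prop where
  isOpen_left : IsOpen P
  isOpen_right : IsOpen N
  disjoint_sides : Disjoint P N
  compl_iUnion : (⋃ i, C i)ᶜ = P ∪ N
  isClosed : ∀ i, IsClosed (C i)
  isConnected : ∀ i, IsConnected (C i)
  pairwise_disjoint : Pairwise fun i j => Disjoint (C i) (C j)
  isSideAt_left : ∀ i, ∀ c ∈ C i, IsSideAt P c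
  isSideAt_right : ∀ i, ∀ c ∈ C i, IsSideAt N c

/-- The open sets `A` and `B` separate the complement of the closed set `K`; neither is required
to be connected or nonempty. -/
structure IsSeparation (K A B : Set X) : Prop where
  isOpen_left : IsOpen A
  isOpen_right : IsOpen B
  disjoint : Disjoint A B
  union_eq : A ∪ B = Kᶜ

/-- The open sets `A` and `B` separate the complement of `K` and contain, near `K`, its sides `P`
and `N`, respectively. -/
structure SeparatesSides (P N K A B : Set X) : Prop extends IsSeparation K A B where
  eventually_iff : ∀ c ∈ K, ∀ᶠ x in 𝓝 c, (x ∈ A ↔ x ∈ P) ∧ (x ∈ B ↔ x ∈ N)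

variable {P N K A B : Set X} {C D D' : ι → Set X}

lemma IsTwoSidedCurve.symm (h : IsTwoSidedCurve P N C) : IsTwoSidedCurve N P C where
  isOpen_left := h.isOpen_right
  isOpen_right := h.isOpen_left
  disjoint_sides := h.disjoint_sides.symm
  compl_iUnion := by rw [h.compl_iUnion, union_comm]
  isClosed := h.isClosed
  isConnected := h.isConnected
  pairwise_disjoint := h.pairwise_disjoint
  isSideAt_left := h.isSideAt_right
  isSideAt_right := h.isSideAt_left

lemma IsTwoSidedCurve.union_subset_compl (h : IsTwoSidedCurve P N C) (i : ι) :
    P ∪ N ⊆ (C i)ᶜ :=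
  h.compl_iUnion ▸ compl_subset_compl.2 (subset_iUnion C i)

lemma IsTwoSidedCurve.eventually_mem_union [Finite ι] (h : IsTwoSidedCurve P N C) {i : ι} {c : X}
    (hc : c ∈ C i) : ∀ᶠ x in 𝓝 c, x ∉ C i → x ∈ P ∪ N := by
  have hother : ∀ᶠ x in 𝓝 c, ∀ j, j ≠ i → x ∉ C j := by
    refine eventually_all.2 fun j => ?_
    by_cases hj : j = i
    · simp [hj]
    · filter_upwards [(h.isClosed j).isOpen_compl.mem_nhds
        (disjoint_right.1 (h.pairwise_disjoint hj) hc)] with x hx _ using hx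
  filter_upwards [hother] with x hx hxi
  rw [← h.compl_iUnion, mem_compl_iff, mem_iUnion, not_exists]
  intro j
  by_cases hj : j = i
  · exact hj ▸ hxi
  · exact hx j hj

lemma IsSeparation.symm (h : IsSeparation K A B) : IsSeparation K B A :=
  ⟨h.isOpen_right, h.isOpen_left, h.disjoint.symm, union_comm A B ▸ h.union_eq⟩

lemma SeparatesSides.symm (h : SeparatesSides P N K A B) : SeparatesSides N P K B A :=
  ⟨h.toIsSeparation.symm, fun c hc => (h.eventually_iff c hc).mono fun _ => And.symm⟩

lemma IsSeparation.compl_right (h : IsSeparation K A B) : Bᶜ = K ∪ A := by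
  ext x
  have hAB := @disjoint_left.1 h.disjoint x
  have hK : x ∈ A ∪ B ↔ x ∈ Kᶜ := by rw [h.union_eq]
  simp only [mem_compl_iff, mem_union] at hK ⊢
  tauto

lemma exists_isSeparation (hK : IsClosed K) (hsep : ¬ IsPreconnected Kᶜ) :
    ∃ A B, IsSeparation K A B ∧ A.Nonempty ∧ B.Nonempty := by
  rw [IsPreconnected] at hsep
  push Not at hsep
  obtain ⟨A, B, hA, hB, hcov, ⟨a, ha⟩, ⟨b, hb⟩, hAB⟩ := hsep
  refine ⟨A ∩ Kᶜ, B ∩ Kᶜ, ⟨hA.inter hK.isOpen_compl, hB.inter hK.isOpen_compl, ?_, ?_⟩,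
    ⟨a, ha.symm⟩, ⟨b, hb.symm⟩⟩
  · exact disjoint_left.2 fun x hx hx' => notMem_empty x (hAB ▸ ⟨hx.2, hx.1, hx'.1⟩)
  · rw [← union_inter_distrib_right, inter_eq_right.2 hcov]

lemma IsSeparation.not_forall_eventually_mem_left [PreconnectedSpace X]
    (h : IsSeparation K A B) (hK : K.Nonempty) (hB : B.Nonempty) :
    ¬ ∀ c ∈ K, ∀ᶠ x in 𝓝 c, x ∉ K → x ∈ A := by
  intro hA
  have hopen : IsOpen Bᶜ := by
    rw [h.compl_right, isOpen_iff_mem_nhds]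
    rintro x (hx | hx)
    · filter_upwards [hA x hx] with y hy
      exact or_iff_not_imp_left.2 hy
    · exact mem_of_superset (h.isOpen_left.mem_nhds hx) subset_union_right
  rcases isClopen_iff.1 ⟨⟨hopen⟩, h.isOpen_right⟩ with hB' | hB'
  · exact hB.ne_empty hB'
  · obtain ⟨c, hc⟩ := hK
    exact (hB' ▸ h.compl_right.ge (.inl hc) : c ∈ univᶜ) (mem_univ c)

lemma IsTwoSidedCurve.exists_separatesSides [PreconnectedSpace X] [Finite ι]
    (h : IsTwoSidedCurve P N C) {i : ι} (hsep : ¬ IsPreconnected (C i)ᶜ) :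
    ∃ A B, SeparatesSides P N (C i) A B := by
  obtain ⟨A, B, hs, hA, hB⟩ := exists_isSeparation (h.isClosed i) hsep
  have not_same {A B : Set X} (hs : IsSeparation (C i) A B) (hB : B.Nonempty)
      (hP : ∀ c ∈ C i, ∀ᶠ x in 𝓝 c, x ∈ P → x ∈ A)
      (hN : ∀ c ∈ C i, ∀ᶠ x in 𝓝 c, x ∈ N → x ∈ A) : False := by
    refine hs.not_forall_eventually_mem_left (h.isConnected i).nonempty hB fun c hc => ?_
    filter_upwards [hP c hc, hN c hc, h.eventually_mem_union hc] with x hxP hxN hx hxC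
    exact (hx hxC).elim hxP hxN
  have separatesSides {A B : Set X} (hs : IsSeparation (C i) A B)
      (hP : ∀ c ∈ C i, ∀ᶠ x in 𝓝 c, x ∈ P → x ∈ A)
      (hN : ∀ c ∈ C i, ∀ᶠ x in 𝓝 c, x ∈ N → x ∈ B) : SeparatesSides P N (C i) A B := by
    refine ⟨hs, fun c hc => ?_⟩
    filter_upwards [hP c hc, hN c hc, h.eventually_mem_union hc] with x hxP hxN hx
    have hAB := @disjoint_left.1 hs.disjoint x
    have hC : x ∈ A ∪ B ↔ x ∈ (C i)ᶜ := by rw [hs.union_eq]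
    simp only [mem_union, mem_compl_iff] at hx hC
    tauto
  have subset_or_subset {H : Set X} (hH : ∀ c ∈ C i, IsSideAt H c) (hHU : H ⊆ P ∪ N) :=
    side_subset_or_subset (h.isConnected i).isPreconnected hH hs.isOpen_left hs.isOpen_right
      hs.disjoint fun c _ => .of_forall fun x hx =>
        hs.union_eq.ge (h.union_subset_compl i (hHU hx))
  rcases subset_or_subset (h.isSideAt_left i) subset_union_left with hP | hP <;>
    rcases subset_or_subset (h.isSideAt_right i) subset_union_right with hN | hN
  · exact (not_same hs hB hP hN).elim
  · exact ⟨A, B, separatesSides hs hP hN⟩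
  · exact ⟨B, A, separatesSides hs.symm hP hN⟩
  · exact (not_same hs.symm hA hP hN).elim

/-- The component `C i` of a two-sided curve separates its complement into an inside `D i` and an
outside `D' i`, each containing one side of `C i`. -/
structure IsInsideOutside (P N : Set X) (C D D' : ι → Set X) : Prop
    extends IsTwoSidedCurve P N C where
  separatesSides : ∀ i,
    SeparatesSides P N (C i) (D i) (D' i) ∨ SeparatesSides N P (C i) (D i) (D' i)

namespace IsInsideOutside

lemma symm (h : IsInsideOutside P N C D D') : IsInsideOutside N P C D D' :=
  ⟨h.toIsTwoSidedCurve.symm, fun i => (h.separatesSides i).symm⟩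

lemma isSeparation (h : IsInsideOutside P N C D D') (i : ι) : IsSeparation (C i) (D i) (D' i) :=
  (h.separatesSides i).elim (·.toIsSeparation) (·.toIsSeparation)

lemma isSideAt_inside (h : IsInsideOutside P N C D D') {i : ι} {c : X} (hc : c ∈ C i) :
    IsSideAt (D i) c := by
  rcases h.separatesSides i with hs | hs
  · exact (h.isSideAt_left i c hc).congr ((hs.eventually_iff c hc).mono fun _ h => h.1.symm)
  · exact (h.isSideAt_right i c hc).congr ((hs.eventually_iff c hc).mono fun _ h => h.1.symm)

lemma isSideAt_outside (h : IsInsideOutside P N C D D') {i : ι} {c : X} (hc : c ∈ C i) :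
    IsSideAt (D' i) c := by
  rcases h.separatesSides i with hs | hs
  · exact (h.isSideAt_right i c hc).congr ((hs.eventually_iff c hc).mono fun _ h => h.2.symm)
  · exact (h.isSideAt_left i c hc).congr ((hs.eventually_iff c hc).mono fun _ h => h.2.symm)

lemma nonempty_inside (h : IsInsideOutside P N C D D') (i : ι) : (D i).Nonempty :=
  let ⟨_, hc⟩ := (h.isConnected i).nonempty
  (h.isSideAt_inside hc).frequently.exists

lemma pairwise_disjoint_union (h : IsInsideOutside P N C D D')
    (hD : Pairwise fun i j => Disjoint (D i) (D j)) :
    Pairwise fun i j => Disjoint (C i ∪ D i) (C j ∪ D j) := by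
  have disjoint_inside {i j : ι} (hij : i ≠ j) : Disjoint (D i) (C j) := by
    refine disjoint_left.2 fun x hi hj => ?_
    obtain ⟨y, hyj, hyi⟩ := ((h.isSideAt_inside hj).frequently.and_eventually
      ((h.isSeparation i).isOpen_left.mem_nhds hi)).exists
    exact disjoint_left.1 (hD hij) hyi hyj
  intro i j hij
  rw [disjoint_union_left, disjoint_union_right, disjoint_union_right]
  exact ⟨⟨h.pairwise_disjoint hij, (disjoint_inside hij.symm).symm⟩, disjoint_inside hij, hD hij⟩

lemma compl_iInter_outside (h : IsInsideOutside P N C D D') :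
    (⋂ i, D' i)ᶜ = ⋃ i, (C i ∪ D i) := by
  rw [compl_iInter]
  exact iUnion_congr fun i => (h.isSeparation i).compl_right

lemma iInter_outside_subset (h : IsInsideOutside P N C D D') : ⋂ i, D' i ⊆ P ∪ N := by
  rw [← h.compl_iUnion, ← compl_subset_compl, compl_compl, h.compl_iInter_outside]
  exact iUnion_mono fun i => subset_union_left

lemma inside_subset (h : IsInsideOutside P N C D D')
    (hD : Pairwise fun i j => Disjoint (D i) (D j)) (i : ι) : D i ⊆ P ∪ N := by
  rw [← h.compl_iUnion, subset_compl_iff_disjoint_right, disjoint_iUnion_right]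
  intro j
  rcases eq_or_ne i j with rfl | hij
  · exact subset_compl_iff_disjoint_right.1 ((h.isSeparation i).union_eq ▸ subset_union_left)
  · exact (h.pairwise_disjoint_union hD hij).mono subset_union_right subset_union_left

lemma isOpen_union_insides (h : IsInsideOutside P N C D D') (hA : IsOpen A) {I : Set ι}
    (hI : ∀ i ∈ I, ∀ c ∈ C i, ∀ᶠ x in 𝓝 c, x ∈ D' i → x ∈ A) :
    IsOpen (A ∪ ⋃ i ∈ I, (C i ∪ D i)) := by
  refine isOpen_iff_mem_nhds.2 fun x hx => ?_
  by_cases hxA : x ∈ A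
  · exact mem_of_superset (hA.mem_nhds hxA) subset_union_left
  obtain ⟨i, hi, hxC | hxD⟩ := mem_iUnion₂.1 (hx.resolve_left hxA)
  · filter_upwards [hI i hi x hxC] with y hy
    by_cases hyD' : y ∈ D' i
    · exact .inl (hy hyD')
    · exact .inr (mem_iUnion₂.2 ⟨i, hi, (h.isSeparation i).compl_right.le hyD'⟩)
  · filter_upwards [(h.isSeparation i).isOpen_left.mem_nhds hxD] with y hy
    exact .inr (mem_iUnion₂.2 ⟨i, hi, .inr hy⟩)

variable [Finite ι]

lemma isOpen_iInter_outside (h : IsInsideOutside P N C D D') : IsOpen (⋂ i, D' i) :=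
  isOpen_iInter_of_finite fun i => (h.isSeparation i).isOpen_right

lemma eventually_mem_iInter_outside (h : IsInsideOutside P N C D D')
    (hD : Pairwise fun i j => Disjoint (D i) (D j)) {i : ι} {c : X} (hc : c ∈ C i) :
    ∀ᶠ x in 𝓝 c, x ∈ D' i → x ∈ ⋂ j, D' j := by
  have hother : ∀ᶠ x in 𝓝 c, ∀ j, j ≠ i → x ∈ D' j := by
    refine eventually_all.2 fun j => ?_
    by_cases hj : j = i
    · simp [hj]
    · have hcj : c ∈ D' j := by
        rw [← notMem_compl_iff, (h.isSeparation j).compl_right]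
        exact disjoint_right.1 (h.pairwise_disjoint_union hD hj) (.inl hc)
      filter_upwards [(h.isSeparation j).isOpen_right.mem_nhds hcj] with x hx _ using hx
  filter_upwards [hother] with x hx hxi
  refine mem_iInter.2 fun j => ?_
  by_cases hj : j = i
  · exact hj ▸ hxi
  · exact hx j hj

variable [PreconnectedSpace X]

lemma isPreconnected_iInter_outside (h : IsInsideOutside P N C D D')
    (hD : Pairwise fun i j => Disjoint (D i) (D j)) : IsPreconnected (⋂ i, D' i) := by
  refine isPreconnected_iff_subset_of_disjoint.2 fun A B hA hB hcov hAB => ?_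
  set O := ⋂ i, D' i
  have hO : IsOpen O := h.isOpen_iInter_outside
  have hAO := hO.inter hA
  have hBO := hO.inter hB
  have hdisj : Disjoint (O ∩ A) (O ∩ B) := by
    rw [disjoint_iff_inter_eq_empty, ← inter_inter_distrib_left, hAB]
  have hunion : O ∩ A ∪ O ∩ B = O := by rw [← inter_union_distrib_left, inter_eq_left.2 hcov]
  have hside (i : ι) := side_subset_or_subset (h.isConnected i).isPreconnected
    (fun c hc => h.isSideAt_outside hc) hAO hBO hdisj
    fun c hc => (h.eventually_mem_iInter_outside hD hc).mono fun x hx hxi => hunion.ge (hx hxi)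
  let I : Set ι := {i | ∀ c ∈ C i, ∀ᶠ x in 𝓝 c, x ∈ D' i → x ∈ O ∩ A}
  set U := O ∩ A ∪ ⋃ i ∈ I, (C i ∪ D i)
  set V := O ∩ B ∪ ⋃ i ∈ Iᶜ, (C i ∪ D i)
  have hU : IsOpen U := h.isOpen_union_insides hAO fun i hi => hi
  have hV : IsOpen V := h.isOpen_union_insides hBO fun i hi => (hside i).resolve_left hi
  have hOK (J : Set ι) : Disjoint O (⋃ i ∈ J, (C i ∪ D i)) := by
    rw [← subset_compl_iff_disjoint_right, subset_compl_comm, h.compl_iInter_outside]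
    exact iUnion₂_subset fun i _ => subset_iUnion (fun i => C i ∪ D i) i
  have hUV : Disjoint U V := by
    rw [disjoint_union_left, disjoint_union_right, disjoint_union_right]
    refine ⟨⟨hdisj, (hOK _).mono_left inter_subset_left⟩,
      ((hOK _).mono_left inter_subset_left).symm, ?_⟩
    simp only [disjoint_iUnion_left, disjoint_iUnion_right]
    exact fun i hi j hj => h.pairwise_disjoint_union hD (ne_of_mem_of_not_mem hj hi)
  have hcover : univ ⊆ U ∪ V := by
    intro x _
    by_cases hx : x ∈ O
    · exact (hunion.ge hx).imp .inl .inl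
    · obtain ⟨i, hi⟩ := mem_iUnion.1 (h.compl_iInter_outside.le hx)
      exact (em (i ∈ I)).imp (fun hI => .inr (mem_iUnion₂.2 ⟨i, hI, hi⟩))
        fun hI => .inr (mem_iUnion₂.2 ⟨i, hI, hi⟩)
  refine (isPreconnected_univ.subset_or_subset hU hV hUV hcover).imp (fun hsub x hx => ?_)
    fun hsub x hx => ?_
  · exact ((hsub (mem_univ x)).resolve_right (disjoint_left.1 (hOK _) hx)).2
  · exact ((hsub (mem_univ x)).resolve_right (disjoint_left.1 (hOK _) hx)).2

lemma inside_subset_right (h : IsInsideOutside P N C D D')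
    (hD : Pairwise fun i j => Disjoint (D i) (D j)) (hO : ⋂ i, D' i ⊆ P) (i : ι) : D i ⊆ N := by
  have hside : SeparatesSides N P (C i) (D i) (D' i) := by
    refine (h.separatesSides i).resolve_left fun hs => ?_
    obtain ⟨c, hc⟩ := (h.isConnected i).nonempty
    obtain ⟨x, hx, hxO, hiff⟩ := ((h.isSideAt_outside hc).frequently.and_eventually
      ((h.eventually_mem_iInter_outside hD hc).and (hs.eventually_iff c hc))).exists
    exact disjoint_left.1 h.disjoint_sides (hO (hxO hx)) (hiff.2.1 hx)
  have hclosed : IsClosed (D i ∩ P) := by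
    refine ⟨isOpen_iff_mem_nhds.2 fun x hx => ?_⟩
    by_cases hxD : x ∈ D i
    · have hxN : x ∈ N := (h.inside_subset hD i hxD).resolve_left fun hxP => hx ⟨hxD, hxP⟩
      filter_upwards [h.isOpen_right.mem_nhds hxN] with y hy hy'
      exact disjoint_left.1 h.disjoint_sides hy'.2 hy
    by_cases hxC : x ∈ C i
    · filter_upwards [hside.eventually_iff x hxC] with y hy hy'
      exact disjoint_left.1 h.disjoint_sides hy'.2 (hy.1.1 hy'.1)
    · have hxD' : x ∈ D' i := (hside.union_eq.ge hxC).resolve_left hxD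
      filter_upwards [hside.isOpen_right.mem_nhds hxD'] with y hy hy'
      exact disjoint_left.1 hside.disjoint hy'.1 hy
  have hempty : D i ∩ P = ∅ := by
    refine (isClopen_iff.1 ⟨hclosed, hside.isOpen_left.inter h.isOpen_left⟩).resolve_right ?_
    intro huniv
    obtain ⟨c, hc⟩ := (h.isConnected i).nonempty
    exact hside.union_eq.le (.inl (huniv.ge (mem_univ c)).1) hc
  exact fun x hx => (h.inside_subset hD i hx).resolve_left fun hxP => hempty.le ⟨hx, hxP⟩

lemma eq_sides (h : IsInsideOutside P N C D D') (hD : Pairwise fun i j => Disjoint (D i) (D j))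
    (hO : ⋂ i, D' i ⊆ P) : ⋂ i, D' i = P ∧ ⋃ i, D i = N := by
  have hDN : ⋃ i, D i ⊆ N := iUnion_subset (h.inside_subset_right hD hO)
  have hcov : P ∪ N ⊆ (⋂ i, D' i) ∪ ⋃ i, D i := by
    intro x hx
    by_contra! hx'
    rw [mem_union, not_or, ← mem_compl_iff, h.compl_iInter_outside, mem_iUnion] at hx'
    obtain ⟨⟨i, hi⟩, hxD⟩ := hx'
    exact h.union_subset_compl i hx (hi.resolve_right fun hi => hxD (mem_iUnion.2 ⟨i, hi⟩))
  have hPN := disjoint_left.1 h.disjoint_sides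
  exact ⟨hO.antisymm fun x hx => (hcov (.inl hx)).resolve_right fun hxD => hPN hx (hDN hxD),
    hDN.antisymm fun x hx => (hcov (.inr hx)).resolve_left fun hxO => hPN (hO hxO) hx⟩

end IsInsideOutside

end TwoSidedCurve

/-! ### A non-orientable component of the complement -/

/-- Across the zero `v` of `F`, from `F > 0` to `F < 0`, the sign `s` is multiplied by `δ`. -/
def HasJumpAt (F : MvPolynomial (Fin 3) ℝ) (s : (Fin 3 → ℝ) → ℤˣ) (δ : ℤˣ)
    (v : Fin 3 → ℝ) : Prop :=
  ∃ ε, ∀ᶠ x in 𝓝 v, (0 < eval x F → s x = ε) ∧ (eval x F < 0 → s x = δ * ε)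

section Jump

variable {F : MvPolynomial (Fin 3) ℝ} {n : ℕ} {s : (Fin 3 → ℝ) → ℤˣ} {δ : ℤˣ} {v : Fin 3 → ℝ}

lemma HasJumpAt.eventually_nhds (h : HasJumpAt F s δ v) : ∀ᶠ x in 𝓝 v, HasJumpAt F s δ x :=
  let ⟨ε, hε⟩ := h
  hε.eventually_nhds.mono fun _ hx => ⟨ε, hx⟩

lemma HasJumpAt.mul {s' : (Fin 3 → ℝ) → ℤˣ} {δ' : ℤˣ} (h : HasJumpAt F s δ v)
    (h' : HasJumpAt F s' δ' v) : HasJumpAt F (s * s') (δ * δ') v := by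
  obtain ⟨ε, hε⟩ := h
  obtain ⟨ε', hε'⟩ := h'
  refine ⟨ε * ε', ?_⟩
  filter_upwards [hε, hε'] with x hx hx'
  exact ⟨fun h => by rw [Pi.mul_apply, hx.1 h, hx'.1 h],
    fun h => by rw [Pi.mul_apply, hx.2 h, hx'.2 h, mul_mul_mul_comm]⟩

lemma HasJumpAt.prod {ι : Type*} [Fintype ι] {s : ι → (Fin 3 → ℝ) → ℤˣ} {δ : ι → ℤˣ}
    (h : ∀ i, HasJumpAt F (s i) (δ i) v) : HasJumpAt F (∏ i, s i) (∏ i, δ i) v := by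
  choose ε hε using h
  refine ⟨∏ i, ε i, ?_⟩
  filter_upwards [eventually_all.2 hε] with x hx
  exact ⟨fun h => by simp [fun i => (hx i).1 h],
    fun h => by simp [fun i => (hx i).2 h, Finset.prod_mul_distrib]⟩

lemma hasJumpAt_one_of_eventually_eq {ε : ℤˣ} (h : ∀ᶠ x in 𝓝 v, s x = ε) : HasJumpAt F s 1 v :=
  ⟨ε, h.mono fun x hx => by simp [hx]⟩

lemma HasJumpAt.unique (hs : IsSmoothCurve F) (hv : v ≠ 0) (hFv : eval v F = 0) {δ' : ℤˣ}
    (h : HasJumpAt F s δ v) (h' : HasJumpAt F s δ' v) : δ = δ' := by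
  obtain ⟨ε, hε⟩ := h
  obtain ⟨ε', hε'⟩ := h'
  obtain ⟨x, hx, hxε, hxε'⟩ :=
    ((hs.isSideAt_eval_pos hv hFv).frequently.and_eventually (hε.and hε')).exists
  obtain ⟨y, hy, hyε, hyε'⟩ :=
    ((hs.isSideAt_eval_neg hv hFv).frequently.and_eventually (hε.and hε')).exists
  have heq : ε = ε' := (hxε.1 hx).symm.trans (hxε'.1 hx)
  exact mul_right_cancel (heq ▸ (hyε.2 hy).symm.trans (hyε'.2 hy) : δ * ε = δ' * ε)

lemma IsSideAt.exists_eventually_eq {X Y : Type*} [TopologicalSpace X] {H : Set X} {c : X}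
    (h : IsSideAt H c) {f : X → Y} (hf : ∀ᶠ x in 𝓝 c, x ∈ H → ∀ᶠ y in 𝓝 x, f y = f x) :
    ∃ b, ∀ᶠ x in 𝓝 c, x ∈ H → f x = b := by
  obtain ⟨W, hW, hWf, ⟨y, hy⟩, hWH⟩ := h _ hf
  let : TopologicalSpace Y := ⊥
  have : DiscreteTopology Y := ⟨rfl⟩
  have hcont : ContinuousOn f (W ∩ H) := fun x hx =>
    (tendsto_nhds_of_eventually_eq (hWf hx.1 hx.2)).mono_left nhdsWithin_le_nhds
  exact ⟨f y, mem_of_superset hW fun x hx hxH => hWH.constant hcont ⟨hx, hxH⟩ hy⟩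

variable (hF : F.IsHomogeneous n) (hn : Even n) (hsm : IsSmoothCurve F)
  (hs : IsOddSignOn (zeroLocus F)ᶜ s)

include hF hn hs

lemma IsOddSignOn.hasJumpAt_one_of_eval_ne_zero (hv : v ≠ 0) (hFv : eval v F ≠ 0) :
    HasJumpAt F s 1 v :=
  hasJumpAt_one_of_eventually_eq
    (hs.eventually_eq v hv (mt (pr_mem_zeroLocus hF hn hv).1 hFv))

lemma HasJumpAt.smul (h : HasJumpAt F s δ v) (hv : v ≠ 0) {c : ℝ} (hc : c ≠ 0) :
    HasJumpAt F s δ (c • v) := by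
  obtain ⟨ε, hε⟩ := h
  refine ⟨unitSign c * ε, ?_⟩
  have htendsto : Tendsto (fun x => c⁻¹ • x) (𝓝 (c • v)) (𝓝 v) := by
    simpa [inv_smul_smul₀ hc] using (continuous_const_smul c⁻¹).tendsto (c • v)
  filter_upwards [htendsto.eventually hε, htendsto.eventually_ne hv] with x hx hx0
  obtain ⟨y, rfl⟩ : ∃ y, x = c • y := ⟨c⁻¹ • x, (smul_inv_smul₀ hc x).symm⟩
  rw [inv_smul_smul₀ hc] at hx hx0
  have hsmul (hy : eval y F ≠ 0) : s (c • y) = unitSign c * s y :=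
    hs.map_smul y hx0 (mt (pr_mem_zeroLocus hF hn hx0).1 hy) c hc
  have hcn : 0 < c ^ n := hn.pow_pos hc
  rw [eval_smul_of_isHomogeneous hF, mul_pos_iff_of_pos_left hcn,
    ← neg_pos, ← mul_neg, mul_pos_iff_of_pos_left hcn, neg_pos]
  exact ⟨fun h => by rw [hsmul h.ne', hx.1 h],
    fun h => by rw [hsmul h.ne, hx.2 h, mul_left_comm]⟩

include hsm

lemma IsOddSignOn.exists_hasJumpAt (hv : v ≠ 0) (hFv : eval v F = 0) :
    ∃ δ, HasJumpAt F s δ v := by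
  have hconst : ∀ᶠ x in 𝓝 v, eval x F ≠ 0 → ∀ᶠ y in 𝓝 x, s y = s x := by
    filter_upwards [isOpen_ne.mem_nhds hv] with x hx0 hx
    exact hs.eventually_eq x hx0 (mt (pr_mem_zeroLocus hF hn hx0).1 hx)
  obtain ⟨a, ha⟩ := (hsm.isSideAt_eval_pos hv hFv).exists_eventually_eq
    (hconst.mono fun x hx (hxF : 0 < eval x F) => hx hxF.ne')
  obtain ⟨b, hb⟩ := (hsm.isSideAt_eval_neg hv hFv).exists_eventually_eq
    (hconst.mono fun x hx (hxF : eval x F < 0) => hx hxF.ne)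
  refine ⟨b * a, a, ?_⟩
  filter_upwards [ha, hb] with x hxa hxb
  exact ⟨hxa, fun h => by rw [hxb h, mul_assoc, Int.units_mul_self, mul_one]⟩

lemma IsOddSignOn.exists_forall_hasJumpAt {K : Set RP2} (hK : IsPreconnected K)
    (hKF : K ⊆ zeroLocus F) : ∃ δ, ∀ v, v ≠ 0 → pr v ∈ K → HasJumpAt F s δ v := by
  have hzero (v) (hv : v ≠ 0) (hvK : pr v ∈ K) : eval v F = 0 :=
    (pr_mem_zeroLocus hF hn hv).1 (hKF hvK)
  choose! δ hδ using fun v hv hvK =>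
    hs.exists_hasJumpAt hF hn hsm (v := v) hv (hzero v hv hvK)
  have hrep (v) (hv : v ≠ 0) (hvK : pr v ∈ K) : δ (pr v).rep = δ v := by
    obtain ⟨c, hc, h⟩ := exists_rep_pr hv
    refine .symm (((hδ v hv hvK).smul hF hn hs hv hc).unique hsm (h ▸ (pr v).rep_nonzero) ?_ ?_)
    · rw [← h]
      exact hzero _ (pr v).rep_nonzero (by rwa [pr_rep])
    · rw [← h]
      exact hδ _ (pr v).rep_nonzero (by rwa [pr_rep])
  have hcont : ContinuousOn (fun P : RP2 => δ P.rep) K := by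
    intro P hP
    obtain ⟨v, hv, rfl⟩ := exists_pr_eq P
    refine tendsto_nhds_of_eventually_eq (eventually_nhdsWithin_iff.2 ?_)
    rw [eventually_nhds_pr hv]
    filter_upwards [(hδ v hv hP).eventually_nhds, isOpen_ne.mem_nhds hv] with x hx hx0 hxK
    rw [hrep x hx0 hxK, hrep v hv hP]
    exact (hδ x hx0 hxK).unique hsm hx0 (hzero x hx0 hxK) hx
  rcases K.eq_empty_or_nonempty with rfl | ⟨P, hP⟩
  · exact ⟨1, by simp⟩
  · refine ⟨δ P.rep, fun v hv hvK => ?_⟩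
    rw [hK.constant hcont hP hvK, hrep v hv hvK]
    exact hδ v hv hvK

lemma IsOddSignOn.not_forall_hasJumpAt_one : ¬ ∀ v, v ≠ 0 → HasJumpAt F s 1 v := by
  intro hjump
  have hext (v) (hv : v ≠ 0) : ∃ ε, ∀ᶠ x in 𝓝 v, eval x F ≠ 0 → s x = ε := by
    obtain ⟨ε, hε⟩ := hjump v hv
    exact ⟨ε, hε.mono fun x hx hxF => hxF.lt_or_gt.elim (fun h => by simpa using hx.2 h) hx.1⟩
  choose! t ht using hext
  have t_eq {v} (hv : v ≠ 0) {ε} (h : ∀ᶠ x in 𝓝 v, eval x F ≠ 0 → s x = ε) : t v = ε := by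
    have hfreq : ∃ᶠ x in 𝓝 v, eval x F ≠ 0 := by
      by_cases h : eval v F = 0
      · exact (hsm.isSideAt_eval_pos hv h).frequently.mono fun x (hx : 0 < eval x F) => hx.ne'
      · exact ((continuous_eval F).continuousAt.eventually_ne h).frequently
    obtain ⟨x, hx, hxt, hxε⟩ := (hfreq.and_eventually ((ht v hv).and h)).exists
    exact (hxt hx).symm.trans (hxε hx)
  have hcont : ContinuousOn t {v | v ≠ 0} := by
    refine fun v hv => tendsto_nhds_of_eventually_eq (mem_nhdsWithin_of_mem_nhds ?_)
    filter_upwards [(ht v hv).eventually_nhds, isOpen_ne.mem_nhds hv] with x hx hx0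
    exact t_eq hx0 hx
  have t_neg (v) (hv : v ≠ 0) : t (-v) = -t v := by
    refine t_eq (neg_ne_zero.2 hv) ?_
    have htendsto : Tendsto (fun x => -x) (𝓝 (-v)) (𝓝 v) := by
      simpa using (continuous_neg (G := Fin 3 → ℝ)).tendsto (-v)
    filter_upwards [htendsto.eventually (ht v hv), htendsto.eventually_ne hv] with x hx hx0 hxF
    rw [← neg_one_smul ℝ x, eval_smul_of_isHomogeneous hF, hn.neg_one_pow, one_mul] at hx
    rw [← hx hxF, neg_one_smul, hs.map_neg (neg_ne_zero.1 hx0)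
      (mt (pr_mem_zeroLocus hF hn (neg_ne_zero.1 hx0)).1 hxF), neg_neg]
  obtain ⟨v, hv⟩ := isConnected_ne_zero.nonempty
  have heq := isConnected_ne_zero.isPreconnected.constant hcont hv (neg_ne_zero.2 hv : -v ≠ 0)
  exact units_ne_neg_self _ (heq.trans (t_neg v hv))

end Jump

section NonOrientable

variable {ι : Type*} {F : MvPolynomial (Fin 3) ℝ} {n : ℕ} {C A B : ι → Set RP2}

open Classical in
/-- The sign equal to `δ` on the cone over `B` and to `1` elsewhere. When `B` is one of the two
parts of the complement of an oval, multiplying by it cancels a jump `δ` across that oval. -/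
def jumpSign (B : Set RP2) (δ : ℤˣ) (v : Fin 3 → ℝ) : ℤˣ := if pr v ∈ B then δ else 1

lemma jumpSign_smul (B : Set RP2) (δ : ℤˣ) {c : ℝ} (hc : c ≠ 0) (v : Fin 3 → ℝ) :
    jumpSign B δ (c • v) = jumpSign B δ v := by
  rw [jumpSign, pr_smul hc, jumpSign]

lemma IsSeparation.eventually_jumpSign_eq {K A B : Set RP2} (h : IsSeparation K A B) (δ : ℤˣ)
    {v : Fin 3 → ℝ} (hv : v ≠ 0) (hvK : pr v ∉ K) :
    ∀ᶠ x in 𝓝 v, jumpSign B δ x = jumpSign B δ v := by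
  rcases (h.union_eq ▸ hvK : pr v ∈ A ∪ B) with hvA | hvB
  · filter_upwards [eventually_pr_mem hv h.isOpen_left hvA] with x hx
    simp [jumpSign, disjoint_left.1 h.disjoint hx, disjoint_left.1 h.disjoint hvA]
  · filter_upwards [eventually_pr_mem hv h.isOpen_right hvB] with x hx
    simp [jumpSign, hx, hvB]

lemma SeparatesSides.hasJumpAt_jumpSign (hF : F.IsHomogeneous n) (hn : Even n) {K A B : Set RP2}
    (h : SeparatesSides (posLocus F) (negLocus F) K A B) (δ : ℤˣ) {v : Fin 3 → ℝ} (hv : v ≠ 0)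
    (hvK : pr v ∈ K) : HasJumpAt F (jumpSign B δ) δ v := by
  refine ⟨1, ?_⟩
  filter_upwards [(eventually_nhds_pr hv).1 (h.eventually_iff _ hvK), isOpen_ne.mem_nhds hv]
    with x hx hx0
  rw [pr_mem_posLocus hF hn hx0, pr_mem_negLocus hF hn hx0] at hx
  exact ⟨fun hpos => if_neg fun hB => hpos.not_gt (hx.2.1 hB),
    fun hneg => by simp [jumpSign, hx.2.2 hneg]⟩

lemma not_isOddSignOn_compl_zeroLocus [Finite ι] (hF : F.IsHomogeneous n) (hn : Even n)
    (hsm : IsSmoothCurve F) (h : IsTwoSidedCurve (posLocus F) (negLocus F) C)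
    (hAB : ∀ i, SeparatesSides (posLocus F) (negLocus F) (C i) (A i) (B i))
    (s : (Fin 3 → ℝ) → ℤˣ) : ¬ IsOddSignOn (zeroLocus F)ᶜ s := by
  classical
  have := Fintype.ofFinite ι
  intro hs
  have hC : ⋃ i, C i = zeroLocus F := by
    rw [← compl_inj_iff, h.compl_iUnion, compl_zeroLocus]
  have hCF (i) : C i ⊆ zeroLocus F := hC ▸ subset_iUnion C i
  choose δ hδ using fun i => hs.exists_forall_hasJumpAt hF hn hsm (h.isConnected i).2 (hCF i)
  have hs' : IsOddSignOn (zeroLocus F)ᶜ (s * ∏ i, jumpSign (B i) (δ i)) := by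
    refine ⟨fun v hv hvF c hc => ?_, fun v hv hvF => ?_⟩
    · simp [hs.map_smul v hv hvF c hc, jumpSign_smul _ _ hc, mul_assoc]
    · filter_upwards [hs.eventually_eq v hv hvF, eventually_all.2 fun i =>
        (hAB i).eventually_jumpSign_eq (δ i) hv (mt (@hCF i _) hvF)] with x hx hxi
      simp [hx, hxi]
  refine hs'.not_forall_hasJumpAt_one hF hn hsm fun v hv => ?_
  by_cases hvF : eval v F = 0
  · obtain ⟨i, hi⟩ := mem_iUnion.1 (hC.ge ((pr_mem_zeroLocus hF hn hv).2 hvF))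
    have hjump (j) : HasJumpAt F (jumpSign (B j) (δ j)) (if j = i then δ i else 1) v := by
      split_ifs with hj
      · exact hj ▸ (hAB j).hasJumpAt_jumpSign hF hn (δ j) hv (hj ▸ hi)
      · exact hasJumpAt_one_of_eventually_eq ((hAB j).eventually_jumpSign_eq (δ j) hv
          (disjoint_right.1 (h.pairwise_disjoint hj) hi))
    simpa using (hδ i v hv hi).mul (.prod hjump)
  · exact hs'.hasJumpAt_one_of_eval_ne_zero hF hn hv hvF

lemma exists_isOddSignOn_of_forall_isOrientable {U : Set RP2} (hU : IsOpen U)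
    (hor : ∀ P ∈ U, IsOrientable (connectedComponentIn U P)) : ∃ s, IsOddSignOn U s := by
  have hopen (P) : IsOpen (connectedComponentIn U P) := hU.connectedComponentIn
  have hex (K : Set RP2) :
      ∃ s, (∃ P ∈ U, K = connectedComponentIn U P) → IsOddSignOn K s := by
    by_cases hK : ∃ P ∈ U, K = connectedComponentIn U P
    · obtain ⟨P, hP, rfl⟩ := hK
      obtain ⟨s, hs⟩ := (hor P hP).exists_isOddSignOn (hopen P)
      exact ⟨s, fun _ => hs⟩
    · exact ⟨1, fun h => absurd h hK⟩
  choose s hs using hex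
  have hsv (v) (hv : pr v ∈ U) := hs _ ⟨_, hv, rfl⟩
  refine ⟨fun v => s (connectedComponentIn U (pr v)) v, fun v hv hvU c hc => ?_,
    fun v hv hvU => ?_⟩
  · simpa only [pr_smul hc] using (hsv v hvU).map_smul v hv (mem_connectedComponentIn hvU) c hc
  · filter_upwards [(hsv v hvU).eventually_eq v hv (mem_connectedComponentIn hvU),
      eventually_pr_mem hv (hopen _) (mem_connectedComponentIn hvU)] with x hx hxK
    rw [← connectedComponentIn_eq hxK, hx]

lemma exists_not_isOrientable [Finite ι] (hF : F.IsHomogeneous n) (hn : Even n)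
    (hsm : IsSmoothCurve F) (h : IsTwoSidedCurve (posLocus F) (negLocus F) C)
    (hAB : ∀ i, SeparatesSides (posLocus F) (negLocus F) (C i) (A i) (B i)) :
    ∃ P ∈ (zeroLocus F)ᶜ, ¬ IsOrientable (connectedComponentIn (zeroLocus F)ᶜ P) := by
  by_contra! hor
  have hopen : IsOpen (zeroLocus F)ᶜ := by
    rw [compl_zeroLocus]
    exact h.isOpen_left.union h.isOpen_right
  obtain ⟨s, hs⟩ := exists_isOddSignOn_of_forall_isOrientable hopen hor
  exact not_isOddSignOn_compl_zeroLocus hF hn hsm h hAB s hs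

lemma IsSmoothCurve.isTwoSidedCurve (hsm : IsSmoothCurve F) (hF : F.IsHomogeneous n) (hn : Even n)
    (hC : ∀ i, Nonempty (C i ≃ₜ Circle)) (hdisj : Pairwise fun i j => Disjoint (C i) (C j))
    (hCF : ⋃ i, C i = zeroLocus F) : IsTwoSidedCurve (posLocus F) (negLocus F) C := by
  have hsub (i) : C i ⊆ zeroLocus F := hCF ▸ subset_iUnion C i
  exact {
    isOpen_left := isOpen_posLocus hF hn
    isOpen_right := isOpen_negLocus hF hn
    disjoint_sides := disjoint_posLocus_negLocus F
    compl_iUnion := by rw [hCF, compl_zeroLocus]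
    isClosed := fun i => by
      obtain ⟨e⟩ := hC i
      have : CompactSpace (C i) := e.symm.compactSpace
      exact (isCompact_iff_compactSpace.2 this).isClosed
    isConnected := fun i => by
      obtain ⟨e⟩ := hC i
      have : ConnectedSpace (C i) := e.symm.surjective.connectedSpace e.symm.continuous
      exact isConnected_iff_connectedSpace.2 this
    pairwise_disjoint := hdisj
    isSideAt_left := fun i c hc => hsm.isSideAt_posLocus hF hn (hsub i hc)
    isSideAt_right := fun i c hc => hsm.isSideAt_negLocus hF hn (hsub i hc) }

lemma IsSmoothCurve.exists_isInsideOutside [Finite ι] (hsm : IsSmoothCurve F)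
    (hF : F.IsHomogeneous n) (hn : Even n) (hC : ∀ i, IsOval (C i))
    (hdisj : Pairwise fun i j => Disjoint (C i) (C j)) (hCF : ⋃ i, C i = zeroLocus F) :
    ∃ D D' : ι → Set RP2, IsInsideOutside (posLocus F) (negLocus F) C D D' ∧
      ∃ P ∈ (zeroLocus F)ᶜ, ¬ IsOrientable (connectedComponentIn (zeroLocus F)ᶜ P) ∧
        connectedComponentIn (zeroLocus F)ᶜ P ⊆ ⋂ i, D' i := by
  have h := hsm.isTwoSidedCurve hF hn (fun i => (hC i).1) hdisj hCF
  choose A B hAB using fun i => h.exists_separatesSides (hC i).2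
  obtain ⟨P, hP, hor⟩ := exists_not_isOrientable hF hn hsm h hAB
  have hNC (i) : connectedComponentIn (zeroLocus F)ᶜ P ⊆ A i ∪ B i := by
    rw [(hAB i).union_eq, ← hCF]
    exact (connectedComponentIn_subset _ _).trans (compl_subset_compl.2 (subset_iUnion C i))
  have hside (i) : ∃ D D', connectedComponentIn (zeroLocus F)ᶜ P ⊆ D' ∧
      (SeparatesSides (posLocus F) (negLocus F) (C i) D D' ∨
        SeparatesSides (negLocus F) (posLocus F) (C i) D D') := by
    rcases isPreconnected_connectedComponentIn.subset_or_subset (hAB i).isOpen_left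
      (hAB i).isOpen_right (hAB i).disjoint (hNC i) with hA | hB
    · exact ⟨B i, A i, hA, .inr (hAB i).symm⟩
    · exact ⟨A i, B i, hB, .inl (hAB i)⟩
  choose D D' hN hD using hside
  exact ⟨D, D', ⟨h, hD⟩, P, hP, hor, subset_iInter hN⟩

end NonOrientable

/-! ### Counting the zeros of a form on a line -/

section CountZeros

open Bornology

variable {ι : Type*}

lemma IsSeparation.preimage {X Y : Type*} [TopologicalSpace X] [TopologicalSpace Y] {f : X → Y}
    {K A B : Set Y} (h : IsSeparation K A B) (hf : Continuous f) :
    IsSeparation (f ⁻¹' K) (f ⁻¹' A) (f ⁻¹' B) :=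
  ⟨h.isOpen_left.preimage hf, h.isOpen_right.preimage hf, h.disjoint.preimage f, by
    rw [← preimage_union, h.union_eq, preimage_compl]⟩

lemma IsSeparation.exists_mem_Ioo {K A B : Set ℝ} (h : IsSeparation K A B) {x y : ℝ} (hxy : x < y)
    (hx : x ∈ A) (hy : y ∈ B) : ∃ t ∈ Ioo x y, t ∈ K := by
  by_contra! hK
  have hcov : Icc x y ⊆ A ∪ B := fun t ht => by
    rcases ht.1.eq_or_lt with rfl | hxt
    · exact .inl hx
    rcases ht.2.eq_or_lt with rfl | hty
    · exact .inr hy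
    exact h.union_eq.ge (hK t ⟨hxt, hty⟩)
  obtain ⟨t, -, htA, htB⟩ := isPreconnected_Icc A B h.isOpen_left h.isOpen_right hcov
    ⟨x, left_mem_Icc.2 hxy.le, hx⟩ ⟨y, right_mem_Icc.2 hxy.le, hy⟩
  exact disjoint_left.1 h.disjoint htA htB

lemma two_mul_card_le_natDegree [Fintype ι] {p : Polynomial ℝ} (hp : p ≠ 0)
    {K U V : ι → Set ℝ} (h : ∀ i, IsSeparation (K i) (U i) (V i))
    (hK : Pairwise fun i j => Disjoint (K i) (K j)) (hroot : ∀ i, ∀ t ∈ K i, p.IsRoot t)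
    (hUV : ∀ i, ∃ y ∈ U i, (∃ x ∈ V i, x < y) ∧ ∃ z ∈ V i, y < z) :
    2 * Fintype.card ι ≤ p.natDegree := by
  have hpair (i) : ∃ r : Bool → ℝ, r false < r true ∧ ∀ β, r β ∈ K i := by
    obtain ⟨y, hy, ⟨x, hx, hxy⟩, z, hz, hyz⟩ := hUV i
    obtain ⟨r, hr, hrK⟩ := (h i).symm.exists_mem_Ioo hxy hx hy
    obtain ⟨s, hs, hsK⟩ := (h i).exists_mem_Ioo hyz hy hz
    exact ⟨fun β => bif β then s else r, hr.2.trans hs.1, Bool.forall_bool.2 ⟨hrK, hsK⟩⟩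
  choose r hr hrK using hpair
  have hinj : Function.Injective fun q : Bool × ι => r q.2 q.1 := by
    rintro ⟨β, i⟩ ⟨γ, j⟩ (hq : r i β = r j γ)
    obtain rfl : i = j := by
      by_contra hij
      exact disjoint_left.1 (hK hij) (hrK i β) (hq ▸ hrK j γ)
    cases β <;> cases γ <;> first | rfl | exact absurd hq (hr i).ne | exact absurd hq (hr i).ne'
  calc 2 * Fintype.card ι = (Finset.univ.image fun q : Bool × ι => r q.2 q.1).card := by
        rw [Finset.card_image_of_injective _ hinj, Finset.card_univ, Fintype.card_prod,
          Fintype.card_bool]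
    _ ≤ p.natDegree := Polynomial.card_le_degree_of_subset_roots fun x hx => by
        obtain ⟨q, -, rfl⟩ := Finset.mem_image.1 hx
        exact (Polynomial.mem_roots hp).2 (hroot q.2 _ (hrK q.2 q.1))

/-- A set stable under all homotheties of nonzero ratio, such as the set of the representatives of
the points of a set of `ℙ²(ℝ)`. It may or may not contain `0`. -/
def IsDoubleCone {E : Type*} [SMul ℝ E] (S : Set E) : Prop :=
  ∀ v ∈ S, ∀ c : ℝ, c ≠ 0 → c • v ∈ S

lemma IsDoubleCone.eventually_add_smul_mem {E : Type*} [AddCommGroup E] [Module ℝ E]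
    [TopologicalSpace E] [ContinuousAdd E] [ContinuousSMul ℝ E] {S : Set E} (hS : IsDoubleCone S)
    (hSo : IsOpen S) (a : E) {b : E} (hb : b ∈ S) : ∀ᶠ x : ℝ in cobounded ℝ, a + x • b ∈ S := by
  have hlim : Tendsto (fun x : ℝ => b + x⁻¹ • a) (cobounded ℝ) (𝓝 b) := by
    simpa using tendsto_const_nhds.add ((tendsto_inv₀_cobounded (α := ℝ)).smul_const a)
  filter_upwards [hlim (hSo.mem_nhds hb), eventually_ne_cobounded 0] with x hx hx0
  convert hS _ hx x hx0 using 1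
  rw [smul_add, smul_inv_smul₀ hx0, add_comm]

variable {σ : Type*} {G : MvPolynomial σ ℝ} {d : ℕ}

lemma exists_natDegree_le_eval_eq (hG : G.totalDegree ≤ d) (a b : σ → ℝ) :
    ∃ p : Polynomial ℝ, p.natDegree ≤ d ∧ ∀ x, p.eval x = eval (a + x • b) G := by
  refine ⟨aeval (fun i => Polynomial.C (a i) + Polynomial.C (b i) * Polynomial.X) G, ?_,
    fun x => ?_⟩
  · simpa using aeval_natDegree_le (n := 1) G hG
      (fun i => Polynomial.C (a i) + Polynomial.C (b i) * Polynomial.X)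
      (fun i => by compute_degree)
  · rw [← Polynomial.coe_aeval_eq_eval, comp_aeval_apply, ← coe_aeval_eq_eval]
    refine congrArg (fun g : σ → ℝ => aeval g G) (funext fun i => ?_)
    simp only [map_add, map_mul, Polynomial.aeval_C, Polynomial.aeval_X, Pi.add_apply,
      Pi.smul_apply, smul_eq_mul, Algebra.algebraMap_self, RingHom.id_apply, mul_comm]

lemma isDoubleCone_eval_ne_zero (hG : G.IsHomogeneous d) : IsDoubleCone {v | eval v G ≠ 0} :=
  fun v hv c hc => by
    rw [mem_ofPred_eq, eval_smul_of_isHomogeneous hG]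
    exact mul_ne_zero (pow_ne_zero _ hc) hv

lemma two_mul_card_le_of_line [Fintype ι] (hG : G.IsHomogeneous d) {a b : σ → ℝ}
    (hb : eval b G ≠ 0) {K U V : ι → Set (σ → ℝ)} (h : ∀ i, IsSeparation (K i) (U i) (V i))
    (hVc : ∀ i, IsDoubleCone (V i)) (hab : ∀ x : ℝ, a + x • b ≠ 0)
    (hK : ∀ i j, i ≠ j → K i ∩ K j ⊆ {0}) (hroot : ∀ i, ∀ v ∈ K i, v ≠ 0 → eval v G = 0)
    (hbV : ∀ i, b ∈ V i) (haU : ∀ i, ∃ x : ℝ, a + x • b ∈ U i) : 2 * Fintype.card ι ≤ d := by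
  obtain ⟨p, hpd, hp⟩ := exists_natDegree_le_eval_eq hG.totalDegree_le a b
  have hp0 : p ≠ 0 := by
    obtain ⟨x, hx⟩ := ((isDoubleCone_eval_ne_zero hG).eventually_add_smul_mem
      (isOpen_ne_fun (continuous_eval G) continuous_const) a hb).exists
    rintro rfl
    exact hx (by rw [← hp, Polynomial.eval_zero])
  have hcont : Continuous fun x : ℝ => a + x • b := by fun_prop
  refine (two_mul_card_le_natDegree hp0 (fun i => (h i).preimage hcont) ?_ ?_ ?_).trans hpd
  · exact fun i j hij => disjoint_left.2 fun x hx hx' => hab x (hK i j hij ⟨hx, hx'⟩)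
  · exact fun i x hx => (hp x).trans (hroot i _ hx (hab x))
  · intro i
    obtain ⟨y, hy⟩ := haU i
    have htail := (hVc i).eventually_add_smul_mem (h i).isOpen_right a (hbV i)
    obtain ⟨x, hx, hxy⟩ :=
      ((htail.filter_mono IsOrderBornology.atBot_le_cobounded).and (eventually_lt_atBot y)).exists
    obtain ⟨z, hz, hyz⟩ :=
      ((htail.filter_mono IsOrderBornology.atTop_le_cobounded).and (eventually_gt_atTop y)).exists
    exact ⟨y, hy, ⟨x, hx, hxy⟩, z, hz, hyz⟩

lemma two_mul_card_le_of_plane [Fintype ι] (hG : G.IsHomogeneous d) {a b : σ → ℝ}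
    (hb : eval b G ≠ 0) {K U V : ι → Set (σ → ℝ)} (h : ∀ i, IsSeparation (K i) (U i) (V i))
    (hUc : ∀ i, IsDoubleCone (U i)) (hVc : ∀ i, IsDoubleCone (V i)) (h0 : ∀ i, 0 ∈ K i)
    (hK : ∀ i j, i ≠ j → K i ∩ K j ⊆ {0}) (hroot : ∀ i, ∀ v ∈ K i, v ≠ 0 → eval v G = 0)
    (hbV : ∀ i, b ∈ V i) (habU : ∀ i, ∃ x y : ℝ, x • a + y • b ∈ U i) :
    2 * Fintype.card ι ≤ d := by
  have smul_notMem (i) (c : ℝ) : c • b ∉ U i := fun hc => by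
    rcases eq_or_ne c 0 with rfl | hc0
    · exact (h i).union_eq.le (.inl hc) (by simpa only [zero_smul] using h0 i)
    · exact disjoint_left.1 (h i).disjoint hc (hVc i b (hbV i) c hc0)
  rcases isEmpty_or_nonempty ι with _ | ⟨⟨i₀⟩⟩
  · simp
  refine two_mul_card_le_of_line hG (a := a) hb h hVc ?_ hK hroot hbV fun i => ?_
  · intro t ht
    obtain ⟨x, y, hxy⟩ := habU i₀
    rw [eq_neg_of_add_eq_zero_left ht, smul_neg, smul_smul, ← neg_smul, ← add_smul] at hxy
    exact smul_notMem i₀ _ hxy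
  · obtain ⟨x, y, hxy⟩ := habU i
    have hx : x ≠ 0 := by
      rintro rfl
      exact smul_notMem i y (by simpa only [zero_smul, zero_add] using hxy)
    refine ⟨x⁻¹ * y, ?_⟩
    simpa only [smul_add, inv_smul_smul₀ hx, smul_smul] using hUc i _ hxy x⁻¹ (inv_ne_zero hx)

lemma exists_forall_eq_smul_add_smul {K W : Type*} [Field K] [AddCommGroup W] [Module K W]
    (hW : Module.finrank K W = 2) {b : W} (hb : b ≠ 0) :
    ∃ a : W, ∀ w, ∃ x y : K, w = x • a + y • b := by
  have : FiniteDimensional K W := Module.finite_of_finrank_eq_succ hW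
  obtain ⟨a, ha⟩ : ∃ a, a ∉ Submodule.span K {b} := by
    by_contra! hall
    have := finrank_span_singleton (K := K) hb
    rw [(Submodule.eq_top_iff').2 hall, finrank_top, hW] at this
    norm_num at this
  have hind : LinearIndependent K ![a, b] := by
    rw [LinearIndependent.pair_symm_iff, LinearIndependent.pair_iff' hb]
    exact fun c hc => ha (Submodule.mem_span_singleton.2 ⟨c, hc⟩)
  have hspan := hind.span_eq_top_of_card_eq_finrank (by rw [hW, Fintype.card_fin])
  refine ⟨a, fun w => ?_⟩
  obtain ⟨x, y, hxy⟩ := Submodule.mem_span_pair.1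
    (by simpa using (hspan ▸ Submodule.mem_top : w ∈ Submodule.span K (range ![a, b])))
  exact ⟨y, x, by rw [← hxy, add_comm]⟩

end CountZeros

section Quartic

/-- The set of the vectors that represent a point of `S`. -/
def coneOver (S : Set RP2) : Set (Fin 3 → ℝ) := {v | v ≠ 0 ∧ pr v ∈ S}

lemma isDoubleCone_coneOver (S : Set RP2) : IsDoubleCone (coneOver S) := fun v hv _ hc =>
  ⟨smul_ne_zero hc hv.1, (pr_smul hc v).symm ▸ hv.2⟩

lemma isOpen_coneOver {S : Set RP2} (hS : IsOpen S) : IsOpen (coneOver S) :=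
  continuousOn_pr.isOpen_inter_preimage isOpen_ne hS

lemma IsSeparation.coneOver {K A B : Set RP2} (h : IsSeparation K A B) :
    IsSeparation {v | v ≠ 0 → pr v ∈ K} (coneOver A) (coneOver B) where
  isOpen_left := isOpen_coneOver h.isOpen_left
  isOpen_right := isOpen_coneOver h.isOpen_right
  disjoint := disjoint_left.2 fun _ hA hB => disjoint_left.1 h.disjoint hA.2 hB.2
  union_eq := by
    ext v
    have hAB : pr v ∈ A ∪ B ↔ pr v ∈ Kᶜ := by rw [h.union_eq]
    simp only [RealQuartic.coneOver, mem_union, mem_ofPred_eq, mem_compl_iff, not_forall,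
      exists_prop, ← and_or_left] at hAB ⊢
    rw [hAB]

variable {ι : Type*} {n : ℕ} {F : MvPolynomial (Fin 3) ℝ} {C D D' : ι → Set RP2}

lemma finrank_ker_dotProduct {l : Fin 3 → ℝ} (hl : l ≠ 0) :
    Module.finrank ℝ (LinearMap.ker (dotProductBilin ℝ ℝ l)) = 2 := by
  have hl0 : (dotProductBilin ℝ ℝ l : Module.Dual ℝ (Fin 3 → ℝ)) ≠ 0 := fun h =>
    hl (dotProduct_self_eq_zero.1 congr($h l))
  exact Nat.succ_injective <| (Module.Dual.finrank_ker_add_one_of_ne_zero hl0).trans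
    (Module.finrank_fin_fun ℝ)

lemma two_mul_card_le_of_forall_exists_mem_line [Fintype ι] (hF : F.IsHomogeneous n)
    (hn : Even n) (h : ∀ i, IsSeparation (C i) (D i) (D' i))
    (hdisj : Pairwise fun i j => Disjoint (C i) (C j)) (hC : ∀ i, C i ⊆ zeroLocus F)
    {l : Fin 3 → ℝ} (hl : l ≠ 0) (hD' : ∃ Q ∈ ⋂ i, D' i, Q ∉ zeroLocus F ∧ l ⬝ᵥ Q.rep = 0)
    (hD : ∀ i, ∃ P ∈ D i, l ⬝ᵥ P.rep = 0) : 2 * Fintype.card ι ≤ n := by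
  obtain ⟨Q, hQ, hQF, hlQ⟩ := hD'
  have hQ0 : (⟨Q.rep, hlQ⟩ : LinearMap.ker (dotProductBilin ℝ ℝ l)) ≠ 0 := fun h0 =>
    Q.rep_nonzero congr($h0.1)
  obtain ⟨a, ha⟩ := exists_forall_eq_smul_add_smul (finrank_ker_dotProduct hl) hQ0
  refine two_mul_card_le_of_plane hF (a := a) (b := Q.rep) hQF (fun i => (h i).coneOver)
    (fun i => isDoubleCone_coneOver _) (fun i => isDoubleCone_coneOver _)
    (fun i h0 => (h0 rfl).elim)
    (fun i j hij v hv => ?_) (fun i v hv hv0 => (pr_mem_zeroLocus hF hn hv0).1 (hC i (hv hv0)))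
    (fun i => ⟨Q.rep_nonzero, (pr_rep Q).symm ▸ mem_iInter.1 hQ i⟩) fun i => ?_
  · by_contra hv0
    exact disjoint_left.1 (hdisj hij) (hv.1 hv0) (hv.2 hv0)
  · obtain ⟨P, hP, hlP⟩ := hD i
    obtain ⟨x, y, hxy⟩ := ha ⟨P.rep, hlP⟩
    refine ⟨x, y, ?_⟩
    rw [show x • (a : Fin 3 → ℝ) + y • Q.rep = P.rep from congr($hxy.1).symm]
    exact ⟨P.rep_nonzero, (pr_rep P).symm ▸ hP⟩

lemma exists_dotProduct_eq_zero (v w : Fin 3 → ℝ) :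
    ∃ l : Fin 3 → ℝ, l ≠ 0 ∧ l ⬝ᵥ v = 0 ∧ l ⬝ᵥ w = 0 := by
  obtain ⟨l, hl, hl0⟩ := Submodule.exists_mem_ne_zero_of_ne_bot
    (LinearMap.ker_ne_bot_of_finrank_lt (f := Matrix.mulVecLin ![v, w]) (by simp))
  have h := congrFun (LinearMap.mem_ker.1 hl)
  exact ⟨l, hl0, (dotProduct_comm l v).trans (h 0), (dotProduct_comm l w).trans (h 1)⟩

variable (hF : F.IsHomogeneous 4) (h : IsInsideOutside (posLocus F) (negLocus F) C D D')
  (hCF : ⋃ i, C i = zeroLocus F)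
  (hline : ∀ l : Fin 3 → ℝ, ∃ Q ∈ ⋂ i, D' i, l ⬝ᵥ Q.rep = 0)
include hF h hCF hline

lemma IsInsideOutside.not_meets_three_insides {i j k : ι} (hij : i ≠ j) (hik : i ≠ k)
    (hjk : j ≠ k) {l : Fin 3 → ℝ} (hl : l ≠ 0) (hi : ∃ P ∈ D i, l ⬝ᵥ P.rep = 0)
    (hj : ∃ P ∈ D j, l ⬝ᵥ P.rep = 0) (hk : ∃ P ∈ D k, l ⬝ᵥ P.rep = 0) : False := by
  let e : Fin 3 → ι := ![i, j, k]
  have he : Function.Injective e := by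
    simp [e, Function.Injective, Fin.forall_fin_succ, hij, hik, hjk, hij.symm, hik.symm, hjk.symm]
  obtain ⟨Q, hQ, hlQ⟩ := hline l
  have hQF : Q ∈ (zeroLocus F)ᶜ := compl_zeroLocus F ▸ h.iInter_outside_subset hQ
  have := two_mul_card_le_of_forall_exists_mem_line hF (by decide) (fun m => h.isSeparation (e m))
    (fun _ _ hm => h.pairwise_disjoint (he.ne hm)) (fun m => hCF ▸ subset_iUnion C (e m)) hl
    ⟨Q, mem_iInter.2 fun m => mem_iInter.1 hQ (e m), hQF, hlQ⟩
    (by simpa [e, Fin.forall_fin_succ] using ⟨hi, hj, hk⟩)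
  norm_num at this

lemma IsInsideOutside.disjoint_inside {i j k : ι} (hij : i ≠ j) (hik : i ≠ k) (hjk : j ≠ k) :
    Disjoint (D i) (D j) := by
  rw [disjoint_left]
  intro P hPi hPj
  obtain ⟨Q, hQ⟩ := h.nonempty_inside k
  obtain ⟨l, hl, hlP, hlQ⟩ := exists_dotProduct_eq_zero P.rep Q.rep
  exact h.not_meets_three_insides hF hCF hline hij hik hjk hl ⟨P, hPi, hlP⟩ ⟨P, hPj, hlP⟩
    ⟨Q, hQ, hlQ⟩

lemma IsInsideOutside.isOrientable_inside {i j k : ι} (hij : i ≠ j) (hik : i ≠ k) (hjk : j ≠ k) :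
    IsOrientable (D i) := by
  obtain ⟨P, hP⟩ := h.nonempty_inside j
  obtain ⟨Q, hQ⟩ := h.nonempty_inside k
  obtain ⟨l, hl, hlP, hlQ⟩ := exists_dotProduct_eq_zero P.rep Q.rep
  exact isOrientable_of_forall_ne_zero l fun R hR hlR =>
    h.not_meets_three_insides hF hCF hline hij hik hjk hl ⟨R, hR, hlR⟩ ⟨P, hP, hlP⟩ ⟨Q, hQ, hlQ⟩

end Quartic

section Outside

variable {ι : Type*} {F : MvPolynomial (Fin 3) ℝ} {C D D' : ι → Set RP2}

lemma IsOrientable.mono {U V : Set RP2} (hV : IsOrientable V) (hUV : U ⊆ V) : IsOrientable U := by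
  obtain ⟨ε, hε, hdet⟩ := hV
  exact ⟨ε, fun i => (hε i).mono (inter_subset_inter_left _ hUV), fun i j P hP =>
    hdet i j P ⟨⟨hUV hP.1.1, hP.1.2⟩, hP.2⟩⟩

lemma IsInsideOutside.outside_eq (h : IsInsideOutside (posLocus F) (negLocus F) C D D')
    (hO : IsPreconnected (⋂ i, D' i)) (hD : ∀ i, IsOrientable (D i))
    (hCF : ⋃ i, C i = zeroLocus F) {P : RP2} (hP : P ∈ (zeroLocus F)ᶜ)
    (hor : ¬ IsOrientable (connectedComponentIn (zeroLocus F)ᶜ P))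
    (hPO : connectedComponentIn (zeroLocus F)ᶜ P ⊆ ⋂ i, D' i) : outside F = ⋂ i, D' i := by
  have hOF : ⋂ i, D' i ⊆ (zeroLocus F)ᶜ := compl_zeroLocus F ▸ h.iInter_outside_subset
  refine Subset.antisymm (fun Q hQ => ?_) fun Q hQ => ⟨hOF hQ, ?_⟩
  · by_contra hQO
    obtain ⟨i, hi⟩ := mem_iUnion.1 (h.compl_iInter_outside.le hQO)
    have hQC : Q ∉ C i := fun hC => hQ.1 (hCF.le (mem_iUnion.2 ⟨i, hC⟩))
    refine hQ.2 ((hD i).mono ?_)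
    refine isPreconnected_connectedComponentIn.subset_left_of_subset_union
      (h.isSeparation i).isOpen_left (h.isSeparation i).isOpen_right (h.isSeparation i).disjoint ?_
      ⟨Q, mem_connectedComponentIn hQ.1, hi.resolve_left hQC⟩
    rw [(h.isSeparation i).union_eq]
    exact (connectedComponentIn_subset _ _).trans
      (compl_subset_compl.2 (hCF ▸ subset_iUnion C i))
  · rwa [connectedComponentIn_eq
      (hO.subset_connectedComponentIn hQ hOF (hPO (mem_connectedComponentIn hP)))]

theorem exists_isInsideOutside_outside_eq [Finite ι] (hF : F.IsHomogeneous 4)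
    (hs : IsSmoothCurve F) (hι : 3 ≤ ENat.card ι) (hC : ∀ i, IsOval (C i))
    (hdisj : Pairwise fun i j => Disjoint (C i) (C j)) (hCF : ⋃ i, C i = zeroLocus F) :
    ∃ D D' : ι → Set RP2, IsInsideOutside (posLocus F) (negLocus F) C D D' ∧
      (Pairwise fun i j => Disjoint (D i) (D j)) ∧ outside F = ⋂ i, D' i ∧
      ∀ l : Fin 3 → ℝ, ∃ Q ∈ outside F, l ⬝ᵥ Q.rep = 0 := by
  obtain ⟨D, D', h, P, hP, hor, hPO⟩ := hs.exists_isInsideOutside hF (by decide) hC hdisj hCF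
  have hline (l : Fin 3 → ℝ) : ∃ Q ∈ ⋂ i, D' i, l ⬝ᵥ Q.rep = 0 := by
    by_contra! hl
    exact hor (isOrientable_of_forall_ne_zero l fun Q hQ => hl Q (hPO hQ))
  have hD : Pairwise fun i j => Disjoint (D i) (D j) := fun i j hij => by
    obtain ⟨k, hki, hkj⟩ := ENat.exists_ne_ne_of_three_le hι i j
    exact h.disjoint_inside hF hCF hline hij hki.symm hkj.symm
  have hDo (i) : IsOrientable (D i) := by
    obtain ⟨j, hji, -⟩ := ENat.exists_ne_ne_of_three_le hι i i
    obtain ⟨k, hki, hkj⟩ := ENat.exists_ne_ne_of_three_le hι i j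
    exact h.isOrientable_inside hF hCF hline hji.symm hki.symm hkj.symm
  have hout := h.outside_eq (h.isPreconnected_iInter_outside hD) hDo hCF hP hor hPO
  exact ⟨D, D', h, hD, hout, hout ▸ hline⟩

end Outside

/-! ### Pencils of conics -/

section BinaryForms

variable {ι : Type*}

lemma exists_mem_forall_notMem {E : Type*} [TopologicalSpace E] {S : Set E} (hS : IsPreconnected S)
    {T : ι → Set E} (hT : ∀ i, IsOpen (T i)) (hd : Pairwise fun i j => Disjoint (T i) (T j))
    {i j : ι} (hij : i ≠ j) (hi : (S ∩ T i).Nonempty) (hj : (S ∩ T j).Nonempty) :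
    ∃ t ∈ S, ∀ k, t ∉ T k := by
  by_contra! hcov
  obtain ⟨x, -, hx, hx'⟩ := hS (T i) (⋃ k ≠ i, T k) (hT i) (isOpen_biUnion fun k _ => hT k)
    (fun t ht => by
      obtain ⟨k, hk⟩ := hcov t ht
      rcases eq_or_ne k i with rfl | hki
      · exact .inl hk
      · exact .inr (mem_biUnion (s := {k | k ≠ i}) hki hk))
    hi (hj.mono (inter_subset_inter_right S (subset_biUnion_of_mem (u := T) hij.symm)))
  obtain ⟨k, hk, hxk⟩ := mem_iUnion₂.1 hx'
  exact disjoint_left.1 (hd hk) hxk hx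

lemma exists_ne_zero_forall_notMem {E : Type*} [AddCommGroup E] [Module ℝ E] [TopologicalSpace E]
    [ContinuousAdd E] [ContinuousSMul ℝ E] (hE : 1 < Module.rank ℝ E) [Nontrivial ι] {T : ι → Set E}
    (hT : ∀ i, IsOpen (T i)) (hd : Pairwise fun i j => Disjoint (T i) (T j))
    (hne : ∀ i, (T i).Nonempty) (h0 : ∀ i, 0 ∉ T i) : ∃ b ≠ 0, ∀ i, b ∉ T i := by
  obtain ⟨i, j, hij⟩ := exists_pair_ne ι
  have hne' (i) : ({0}ᶜ ∩ T i).Nonempty := by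
    obtain ⟨t, ht⟩ := hne i
    exact ⟨t, fun h => h0 i (h ▸ ht), ht⟩
  exact exists_mem_forall_notMem (isConnected_compl_singleton_of_one_lt_rank hE 0).isPreconnected
    hT hd hij (hne' i) (hne' j)

variable {σ : Type*} {G : MvPolynomial σ ℝ} {d : ℕ}

lemma isDoubleCone_eval_pos (hG : G.IsHomogeneous d) (hd : Even d) :
    IsDoubleCone {t | 0 < eval t G} := fun t ht c hc => by
  rw [mem_ofPred_eq, eval_smul_of_isHomogeneous hG]
  exact mul_pos (hd.pow_pos hc) ht

lemma isDoubleCone_eval_neg (hG : G.IsHomogeneous d) (hd : Even d) :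
    IsDoubleCone {t | eval t G < 0} := fun t ht c hc => by
  rw [mem_ofPred_eq, eval_smul_of_isHomogeneous hG]
  exact mul_neg_of_pos_of_neg (hd.pow_pos hc) ht

lemma eval_zero_of_isHomogeneous (hG : G.IsHomogeneous d) (hd : d ≠ 0) : eval 0 G = 0 := by
  simpa only [zero_smul, zero_pow hd, zero_mul] using eval_smul_of_isHomogeneous hG 0 0

lemma IsDoubleCone.union {E : Type*} [SMul ℝ E] {S S' : Set E} (hS : IsDoubleCone S)
    (hS' : IsDoubleCone S') : IsDoubleCone (S ∪ S') := fun v hv c hc =>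
  hv.imp (hS v · c hc) (hS' v · c hc)

lemma IsDoubleCone.inter {E : Type*} [SMul ℝ E] {S S' : Set E} (hS : IsDoubleCone S)
    (hS' : IsDoubleCone S') : IsDoubleCone (S ∩ S') := fun v hv c hc =>
  ⟨hS v hv.1 c hc, hS' v hv.2 c hc⟩

lemma isDoubleCone_iUnion {κ : Sort*} {E : Type*} [SMul ℝ E] {S : κ → Set E}
    (hS : ∀ k, IsDoubleCone (S k)) : IsDoubleCone (⋃ k, S k) := fun v hv c hc => by
  obtain ⟨k, hk⟩ := mem_iUnion.1 hv
  exact mem_iUnion.2 ⟨k, hS k v hk c hc⟩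

variable [Fintype ι] [Nontrivial ι] {G : MvPolynomial (Fin 2) ℝ} {d : ℕ} {T : ι → Set (Fin 2 → ℝ)}

lemma two_mul_card_le_of_eval_pos (hG : G.IsHomogeneous d) (hd : Even d) (hd0 : d ≠ 0)
    (hT : ∀ i, IsOpen (T i)) (hTc : ∀ i, IsDoubleCone (T i)) (h0 : ∀ i, 0 ∉ T i)
    (hdisj : Pairwise fun i j => Disjoint (T i) (T j)) (hneg : ∀ i, ∃ t ∈ T i, eval t G < 0)
    (hpos : ∀ t ≠ 0, (∀ i, t ∉ T i) → 0 < eval t G) : 2 * Fintype.card ι ≤ d := by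
  obtain ⟨b, hb0, hb⟩ := exists_ne_zero_forall_notMem (by rw [rank_fin_fun]; norm_num) hT hdisj
    (fun i => (hneg i).imp fun _ => And.left) h0
  obtain ⟨a, ha⟩ := exists_forall_eq_smul_add_smul (K := ℝ) (Module.finrank_fin_fun ℝ) hb0
  let U (i) : Set (Fin 2 → ℝ) := T i ∩ {t | eval t G < 0}
  let V (i) : Set (Fin 2 → ℝ) := {t | 0 < eval t G} ∪ ⋃ j ≠ i, T j
  have hVo (i) : IsOpen (V i) :=
    (isOpen_lt continuous_const (continuous_eval G)).union (isOpen_biUnion fun j _ => hT j)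
  have hUV (i) : Disjoint (U i) (V i) := disjoint_union_right.2
    ⟨disjoint_left.2 fun t ht (h : 0 < eval t G) => h.not_gt ht.2,
      disjoint_iUnion₂_right.2 fun j hj => (hdisj hj.symm).mono_left inter_subset_left⟩
  have mem_T {i t} (ht : t ∉ V i) (ht0 : t ≠ 0) : t ∈ T i := by
    by_contra hti
    refine ht (.inl (hpos t ht0 fun j hj => ?_))
    rcases eq_or_ne j i with rfl | hji
    · exact hti hj
    · exact ht (.inr (mem_biUnion (s := {k | k ≠ i}) hji hj))
  refine two_mul_card_le_of_plane hG (a := a) (hpos b hb0 hb).ne' (U := U) (V := V)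
    (K := fun i => (U i ∪ V i)ᶜ)
    (fun i => ⟨(hT i).inter (isOpen_lt (continuous_eval G) continuous_const), hVo i, hUV i,
      (compl_compl _).symm⟩)
    (fun i => (hTc i).inter (isDoubleCone_eval_neg hG hd))
    (fun i => (isDoubleCone_eval_pos hG hd).union
      (isDoubleCone_iUnion fun j => isDoubleCone_iUnion fun _ => hTc j))
    ?_ ?_ ?_ (fun i => .inl (hpos b hb0 hb)) ?_
  · rintro i (h | h | h)
    · exact h0 i h.1
    · exact h.ne' (eval_zero_of_isHomogeneous hG hd0)
    · obtain ⟨j, -, h⟩ := mem_iUnion₂.1 h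
      exact h0 j h
  · rintro i j hij t ⟨hi, hj⟩
    by_contra ht0
    exact disjoint_left.1 (hdisj hij) (mem_T (fun h => hi (.inr h)) ht0)
      (mem_T (fun h => hj (.inr h)) ht0)
  · intro i t ht ht0
    exact le_antisymm (not_lt.1 fun h => ht (.inr (.inl h)))
      (not_lt.1 fun h => ht (.inl ⟨mem_T (fun h => ht (.inr h)) ht0, h⟩))
  · intro i
    obtain ⟨t, ht⟩ := hneg i
    obtain ⟨x, y, rfl⟩ := ha t
    exact ⟨x, y, ht⟩

lemma two_mul_card_le_of_eval_nonneg (hG : G.IsHomogeneous d) (hd : Even d) (hd0 : d ≠ 0)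
    (hT : ∀ i, IsOpen (T i)) (hTc : ∀ i, IsDoubleCone (T i)) (h0 : ∀ i, 0 ∉ T i)
    (hdisj : Pairwise fun i j => Disjoint (T i) (T j)) (hneg : ∀ i, ∃ t ∈ T i, eval t G < 0)
    (hnonneg : ∀ t, (∀ i, t ∉ T i) → 0 ≤ eval t G) : 2 * Fintype.card ι ≤ d := by
  choose t ht htG using hneg
  let H (δ : ℝ) : MvPolynomial (Fin 2) ℝ := G + C δ * (X 0 ^ d + X 1 ^ d)
  have eval_H (δ : ℝ) (v : Fin 2 → ℝ) : eval v (H δ) = eval v G + δ * (v 0 ^ d + v 1 ^ d) := by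
    simp only [H, map_add, map_mul, map_pow, eval_C, eval_X]
  have hH : ∀ᶠ δ in 𝓝[>] (0 : ℝ), ∀ i, eval (t i) (H δ) < 0 := by
    refine eventually_all.2 fun i => ?_
    have hc : Continuous fun δ => eval (t i) (H δ) := by
      simp only [eval_H]
      fun_prop
    refine (hc.continuousAt.eventually_lt continuousAt_const ?_).filter_mono nhdsWithin_le_nhds
    simpa only [eval_H, zero_mul, add_zero] using htG i
  obtain ⟨δ, hδ, hδ0 : 0 < δ⟩ := (hH.and self_mem_nhdsWithin).exists
  refine two_mul_card_le_of_eval_pos (G := H δ) ?_ hd hd0 hT hTc h0 hdisj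
    (fun i => ⟨t i, ht i, hδ i⟩) fun v hv hvT => ?_
  · exact hG.add (((isHomogeneous_X_pow _ _).add (isHomogeneous_X_pow _ _)).C_mul δ)
  · rw [eval_H]
    refine add_pos_of_nonneg_of_pos (hnonneg v hvT) (mul_pos hδ0 ?_)
    obtain ⟨i, hi⟩ := Function.ne_iff.1 hv
    fin_cases i
    · exact add_pos_of_pos_of_nonneg (hd.pow_pos hi) (hd.pow_nonneg _)
    · exact add_pos_of_nonneg_of_pos (hd.pow_nonneg _) (hd.pow_pos hi)

end BinaryForms

section QuadraticForms

open Matrix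

variable {n : Type*} [Fintype n]

lemma exists_eval_eq_dotProduct {R : Type*} [CommRing R] {L : MvPolynomial n R}
    (hL : L.IsHomogeneous 1) : ∃ c : n → R, ∀ x, eval x L = x ⬝ᵥ c := by
  have hconst (i) : ∃ c, pderiv i L = C c :=
    ⟨_, totalDegree_eq_zero_iff_eq_C.1 ((totalDegree_zero_iff_isHomogeneous n).2 hL.pderiv)⟩
  choose c hc using hconst
  refine ⟨c, fun x => ?_⟩
  rw [← one_smul ℕ L, ← hL.sum_X_mul_pderiv, map_sum]
  simp only [hc, map_mul, eval_X, eval_C, dotProduct]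

lemma exists_isSymm_eval_eq {Q : MvPolynomial n ℝ} (hQ : Q.IsHomogeneous 2) :
    ∃ A : Matrix n n ℝ, A.IsSymm ∧ ∀ x, eval x Q = x ⬝ᵥ A *ᵥ x := by
  choose c hc using fun i => exists_eval_eq_dotProduct (hQ.pderiv (i := i))
  let B : Matrix n n ℝ := of c
  have hB (x) : 2 * eval x Q = x ⬝ᵥ B *ᵥ x := by
    rw [← Nat.cast_two, ← nsmul_eq_mul, ← map_nsmul, ← hQ.sum_X_mul_pderiv, map_sum]
    simp only [map_mul, eval_X, hc, dotProduct_comm x (c _)]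
    rfl
  refine ⟨(4⁻¹ : ℝ) • (B + Bᵀ), ?_, fun x => ?_⟩
  · rw [IsSymm, transpose_smul, transpose_add, transpose_transpose, add_comm]
  · rw [smul_mulVec, add_mulVec, dotProduct_smul, dotProduct_add, dotProduct_mulVec x Bᵀ,
      vecMul_transpose, dotProduct_comm (B *ᵥ x), ← hB, smul_eq_mul]
    ring

lemma quadraticForm_neg_of_mem_segment {E : Type*} [AddCommGroup E] [Module ℝ E]
    {q : QuadraticForm ℝ E} {x y z : E} (hx : q x < 0) (hy : q y < 0)
    (hxy : QuadraticMap.polar q x y ≤ 0) (hz : z ∈ segment ℝ x y) : q z < 0 := by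
  obtain ⟨a, b, ha, hb, hab, rfl⟩ := hz
  have hcross := mul_nonpos_of_nonneg_of_nonpos (mul_nonneg ha hb) hxy
  have hsq : a * a * q x + b * b * q y < 0 := by
    rcases ha.eq_or_lt with rfl | ha
    · obtain rfl : b = 1 := by linarith
      linarith
    · nlinarith [mul_pos ha ha, mul_self_nonneg b]
  rw [QuadraticMap.map_add q, QuadraticMap.map_smul, QuadraticMap.map_smul,
    QuadraticMap.polar_smul_left, QuadraticMap.polar_smul_right]
  simp only [smul_eq_mul]
  linarith

lemma eq_of_quadraticForm_neg {E ι : Type*} [AddCommGroup E] [Module ℝ E] [TopologicalSpace E]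
    [ContinuousAdd E] [ContinuousSMul ℝ E] {q : QuadraticForm ℝ E} {D : ι → Set E}
    (hD : ∀ i, IsOpen (D i)) (hDc : ∀ i, IsDoubleCone (D i))
    (hdisj : Pairwise fun i j => Disjoint (D i) (D j)) (hq : ∀ x, q x < 0 → ∃ i, x ∈ D i)
    {i j : ι} {x y : E} (hxi : x ∈ D i) (hyj : y ∈ D j) (hx : q x < 0) (hy : q y < 0) : i = j := by
  wlog hxy : QuadraticMap.polar q x y ≤ 0 generalizing y
  · refine this (y := -y) ?_ (by rwa [QuadraticMap.map_neg]) ?_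
    · simpa only [neg_smul, one_smul] using hDc j y hyj (-1) (by norm_num)
    · rw [QuadraticMap.polar_neg_right]
      linarith
  by_contra hij
  obtain ⟨z, hzxy, hz⟩ := exists_mem_forall_notMem (convex_segment x y).isPreconnected hD hdisj hij
    ⟨x, left_mem_segment ℝ x y, hxi⟩ ⟨y, right_mem_segment ℝ x y, hyj⟩
  obtain ⟨k, hk⟩ := hq z (quadraticForm_neg_of_mem_segment hx hy hxy hzxy)
  exact hz k hk

lemma dotProduct_mulVec_eq_sum_eigenvalues [DecidableEq n] {A : Matrix n n ℝ} (hA : A.IsHermitian)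
    (x : n → ℝ) :
    x ⬝ᵥ A *ᵥ x = ∑ i, hA.eigenvalues i * (⇑(hA.eigenvectorBasis i) ⬝ᵥ x) ^ 2 := by
  let b := hA.eigenvectorBasis
  have parseval (y z : n → ℝ) : y ⬝ᵥ z = ∑ i, (⇑(b i) ⬝ᵥ y) * (⇑(b i) ⬝ᵥ z) := by
    have h := (b.sum_inner_mul_inner (WithLp.toLp 2 y) (WithLp.toLp 2 z)).symm
    simp only [EuclideanSpace.inner_eq_star_dotProduct, star_trivial] at h
    rw [dotProduct_comm, h]
    exact Finset.sum_congr rfl fun i _ => congrArg _ (dotProduct_comm _ _)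
  rw [parseval]
  refine Finset.sum_congr rfl fun i _ => ?_
  rw [dotProduct_mulVec, ← mulVec_transpose, isHermitian_iff_isSymm.1 hA,
    hA.mulVec_eigenvectorBasis, smul_dotProduct, smul_eq_mul]
  ring

lemma det_neg_of_line_meets_pos {A : Matrix (Fin 3) (Fin 3) ℝ} (hA : A.IsSymm)
    (hneg : ∃ x, x ⬝ᵥ A *ᵥ x < 0) (hpos : ∀ l, ∃ x, l ⬝ᵥ x = 0 ∧ 0 < x ⬝ᵥ A *ᵥ x) :
    A.det < 0 := by
  have hA' : A.IsHermitian := isHermitian_iff_isSymm.2 hA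
  set lam := hA'.eigenvalues
  simp only [dotProduct_mulVec_eq_sum_eigenvalues hA'] at hneg hpos
  have exists_neg : ∃ k, lam k < 0 := by
    obtain ⟨x, hx⟩ := hneg
    by_contra! h
    exact hx.not_ge (Finset.sum_nonneg fun i _ => mul_nonneg (h i) (sq_nonneg _))
  have exists_pos (i) : ∃ j ≠ i, 0 < lam j := by
    obtain ⟨x, hix, hx⟩ := hpos ⇑(hA'.eigenvectorBasis i)
    by_contra! h
    refine hx.not_ge (Finset.sum_nonpos fun j _ => ?_)
    rcases eq_or_ne j i with rfl | hj
    · simp only [hix, ne_eq, OfNat.ofNat_ne_zero, not_false_eq_true, zero_pow, mul_zero, le_refl]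
    · exact mul_nonpos_of_nonpos_of_nonneg (h j hj) (sq_nonneg _)
  obtain ⟨k, hk⟩ := exists_neg
  obtain ⟨j, hjk, hj⟩ := exists_pos k
  obtain ⟨m, hmj, hm⟩ := exists_pos j
  have hmk : m ≠ k := fun h => hk.not_gt (h ▸ hm)
  have huniv : (Finset.univ : Finset (Fin 3)) = {k, j, m} := by
    refine (Finset.eq_univ_of_card _ ?_).symm
    rw [Finset.card_eq_three.2 ⟨k, j, m, hjk.symm, hmk.symm, hmj.symm, rfl⟩, Fintype.card_fin]
  rw [hA'.det_eq_prod_eigenvalues, huniv, Finset.prod_insert, Finset.prod_pair hmj.symm]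
  · exact mul_neg_of_neg_of_pos hk (mul_pos hj hm)
  · simp only [Finset.mem_insert, Finset.mem_singleton, not_or]
    exact ⟨hjk.symm, hmk.symm⟩

end QuadraticForms

section Pencils

open Matrix

/-- The member of parameter `t` of the pencil spanned by `a`, `b`, `c`. -/
def pencil {M : Type*} [AddCommMonoid M] [Module ℝ M] (a b c : M) (t : Fin 2 → ℝ) : M :=
  t 0 ^ 2 • a + (2 * t 0 * t 1) • b + t 1 ^ 2 • c

lemma pencil_smul {M : Type*} [AddCommMonoid M] [Module ℝ M] (a b c : M) (r : ℝ) (t : Fin 2 → ℝ) :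
    pencil a b c (r • t) = r ^ 2 • pencil a b c t := by
  simp only [pencil, Pi.smul_apply, smul_eq_mul, smul_add, smul_smul]
  congr 3 <;> ring

lemma pencil_pos {a b c : ℝ} (ha : 0 < a) (hdisc : 0 < a * c - b ^ 2) {t : Fin 2 → ℝ} (ht : t ≠ 0) :
    0 < pencil a b c t := by
  have key : a * pencil a b c t = (a * t 0 + b * t 1) ^ 2 + (a * c - b ^ 2) * t 1 ^ 2 := by
    simp only [pencil, smul_eq_mul]
    ring
  refine pos_of_mul_pos_right (key ▸ ?_) ha.le
  rcases eq_or_ne (t 1) 0 with h1 | h1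
  · have h0 : t 0 ≠ 0 := fun h0 => ht (funext (Fin.forall_fin_two.2 ⟨h0, h1⟩))
    rw [h1, mul_zero, add_zero, zero_pow two_ne_zero, mul_zero, add_zero]
    positivity
  · exact add_pos_of_nonneg_of_pos (sq_nonneg _) (by positivity)

lemma exists_pencil_neg {a b c : ℝ} (hdisc : a * c - b ^ 2 < 0) : ∃ t, pencil a b c t < 0 := by
  have pencil_eq (x y : ℝ) : pencil a b c ![x, y] = x ^ 2 * a + 2 * x * y * b + y ^ 2 * c := rfl
  rcases lt_trichotomy a 0 with ha | rfl | ha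
  · exact ⟨![1, 0], by rw [pencil_eq]; linarith⟩
  · have hb : b ≠ 0 := by
      rintro rfl
      norm_num at hdisc
    refine ⟨![-(c + 1) / (2 * b), 1], ?_⟩
    have : pencil 0 b c ![-(c + 1) / (2 * b), 1] = -1 := by
      rw [pencil_eq]
      field_simp
      ring
    linarith
  · refine ⟨![-b, a], ?_⟩
    have : pencil a b c ![-b, a] = a * (a * c - b ^ 2) := by
      rw [pencil_eq]
      ring
    exact this ▸ mul_neg_of_pos_of_neg ha hdisc

lemma isHomogeneous_det {σ R n : Type*} [CommRing R] [Fintype n] [DecidableEq n] {d : ℕ}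
    {P : Matrix n n (MvPolynomial σ R)} (hP : ∀ i j, (P i j).IsHomogeneous d) :
    P.det.IsHomogeneous (Fintype.card n * d) := by
  rw [det_apply]
  refine IsHomogeneous.sum _ _ _ fun τ _ => ?_
  have hprod : (∏ i, P (τ i) i).IsHomogeneous (Fintype.card n * d) := by
    simpa only [Finset.sum_const, Finset.card_univ, smul_eq_mul] using
      IsHomogeneous.prod Finset.univ (fun i => P (τ i) i) (fun _ => d) fun i _ => hP _ _
  rcases Int.units_eq_one_or (Equiv.Perm.sign τ) with h | h
  · simpa only [h, one_smul] using hprod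
  · simpa only [h, Units.neg_smul, one_smul] using hprod.neg

lemma exists_eval_eq_det_pencil {n : Type*} [Fintype n] [DecidableEq n] (A B C : Matrix n n ℝ) :
    ∃ G : MvPolynomial (Fin 2) ℝ, G.IsHomogeneous (Fintype.card n * 2) ∧
      ∀ t, eval t G = (pencil A B C t).det := by
  let P (i j : n) : MvPolynomial (Fin 2) ℝ :=
    MvPolynomial.C (A i j) * X 0 ^ 2 + MvPolynomial.C (2 * B i j) * (X 0 * X 1) +
      MvPolynomial.C (C i j) * X 1 ^ 2
  refine ⟨(of P).det, isHomogeneous_det fun i j => ?_, fun t => ?_⟩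
  · exact (((isHomogeneous_X_pow _ _).C_mul _).add
      (((isHomogeneous_X ℝ 0).mul (isHomogeneous_X ℝ 1)).C_mul _)).add
      ((isHomogeneous_X_pow _ _).C_mul _)
  · rw [RingHom.map_det]
    congr 1
    ext i j
    simp only [P, pencil, RingHom.mapMatrix_apply, map_apply, of_apply, map_add, map_mul, map_pow,
      eval_C, eval_X, Matrix.add_apply, Matrix.smul_apply, smul_eq_mul]
    ring

variable {n ι : Type*}

lemma isSymm_pencil {A B C : Matrix n n ℝ} (hA : A.IsSymm) (hB : B.IsSymm) (hC : C.IsSymm)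
    (t : Fin 2 → ℝ) : (pencil A B C t).IsSymm :=
  ((hA.smul _).add (hB.smul _)).add (hC.smul _)

variable [Fintype n]

lemma dotProduct_pencil_mulVec (A B C : Matrix n n ℝ) (t : Fin 2 → ℝ) (x : n → ℝ) :
    x ⬝ᵥ pencil A B C t *ᵥ x = pencil (x ⬝ᵥ A *ᵥ x) (x ⬝ᵥ B *ᵥ x) (x ⬝ᵥ C *ᵥ x) t := by
  simp only [pencil, add_mulVec, smul_mulVec, dotProduct_add, dotProduct_smul]

/-- The parameters `t` such that the member of parameter `t` of a pencil of quadratic forms, given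
by their matrices, takes a negative value on `S`. -/
def negParams (A B C : Matrix n n ℝ) (S : Set (n → ℝ)) : Set (Fin 2 → ℝ) :=
  {t | ∃ x ∈ S, x ⬝ᵥ pencil A B C t *ᵥ x < 0}

lemma isOpen_negParams (A B C : Matrix n n ℝ) (S : Set (n → ℝ)) : IsOpen (negParams A B C S) := by
  have : negParams A B C S = ⋃ x ∈ S, {t | x ⬝ᵥ pencil A B C t *ᵥ x < 0} := by
    ext t
    simp only [negParams, mem_ofPred_eq, mem_iUnion, exists_prop]
  rw [this]
  refine isOpen_biUnion fun x _ => isOpen_lt ?_ continuous_const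
  simp only [dotProduct_pencil_mulVec]
  unfold pencil
  fun_prop

lemma isDoubleCone_negParams (A B C : Matrix n n ℝ) (S : Set (n → ℝ)) :
    IsDoubleCone (negParams A B C S) := by
  rintro t ⟨x, hx, hxt⟩ c hc
  refine ⟨x, hx, ?_⟩
  rw [pencil_smul, smul_mulVec, dotProduct_smul]
  exact smul_neg_of_pos_of_neg (sq_pos_of_ne_zero hc) hxt

lemma zero_notMem_negParams (A B C : Matrix n n ℝ) (S : Set (n → ℝ)) : 0 ∉ negParams A B C S := by
  rintro ⟨x, -, hx⟩
  simp [pencil] at hx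

lemma pairwise_disjoint_negParams {A B C : Matrix n n ℝ} {D : ι → Set (n → ℝ)}
    (hD : ∀ i, IsOpen (D i)) (hDc : ∀ i, IsDoubleCone (D i))
    (hdisj : Pairwise fun i j => Disjoint (D i) (D j))
    (hcov : ∀ t x, x ⬝ᵥ pencil A B C t *ᵥ x < 0 → ∃ i, x ∈ D i) :
    Pairwise fun i j => Disjoint (negParams A B C (D i)) (negParams A B C (D j)) := by
  classical
  refine fun i j hij => disjoint_left.2 ?_
  rintro t ⟨x, hx, hxt⟩ ⟨y, hy, hyt⟩
  let q := (pencil A B C t).toQuadraticForm'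
  have hq (v) : q v = v ⬝ᵥ pencil A B C t *ᵥ v := toLinearMap₂'_apply' _ v v
  exact hij (eq_of_quadraticForm_neg hD hDc hdisj (fun v hv => hcov t v (hq v ▸ hv)) hx hy
    (by rwa [hq]) (by rwa [hq]))

lemma card_le_three_of_pencil [Fintype ι] {A B C : Matrix (Fin 3) (Fin 3) ℝ} (hA : A.IsSymm)
    (hB : B.IsSymm) (hC : C.IsSymm) {D : ι → Set (Fin 3 → ℝ)} (hD : ∀ i, IsOpen (D i))
    (hDc : ∀ i, IsDoubleCone (D i)) (hdisj : Pairwise fun i j => Disjoint (D i) (D j))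
    (hcov : ∀ t x, x ⬝ᵥ pencil A B C t *ᵥ x < 0 → ∃ i, x ∈ D i)
    (hneg : ∀ i, ∃ t, ∃ x ∈ D i, x ⬝ᵥ pencil A B C t *ᵥ x < 0)
    (hline : ∀ l, ∃ x, l ⬝ᵥ x = 0 ∧ ∀ t ≠ 0, 0 < x ⬝ᵥ pencil A B C t *ᵥ x) :
    Fintype.card ι ≤ 3 := by
  rcases subsingleton_or_nontrivial ι with h | _
  · exact (Fintype.card_le_one_iff_subsingleton.2 h).trans (by norm_num)
  have hsymm := isSymm_pencil hA hB hC
  obtain ⟨G, hG, hGdet⟩ := exists_eval_eq_det_pencil A B C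
  have det_neg {i t} (ht : t ∈ negParams A B C (D i)) : (pencil A B C t).det < 0 := by
    have ht0 : t ≠ 0 := fun h => zero_notMem_negParams A B C _ (h ▸ ht)
    obtain ⟨x, -, hx⟩ := ht
    exact det_neg_of_line_meets_pos (hsymm t) ⟨x, hx⟩ fun l =>
      (hline l).imp fun _ hy => ⟨hy.1, hy.2 t ht0⟩
  have det_nonneg {t} (ht : ∀ i, t ∉ negParams A B C (D i)) : 0 ≤ (pencil A B C t).det := by
    refine (PosSemidef.of_dotProduct_mulVec_nonneg (isHermitian_iff_isSymm.2 (hsymm t))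
      fun x => ?_).det_nonneg
    by_contra! hx
    obtain ⟨i, hi⟩ := hcov t x hx
    exact ht i ⟨x, hi, hx⟩
  suffices 2 * Fintype.card ι ≤ 3 * 2 by linarith
  exact two_mul_card_le_of_eval_nonneg hG (by decide) (by decide)
    (fun i => isOpen_negParams A B C (D i)) (fun i => isDoubleCone_negParams A B C (D i))
    (fun i => zero_notMem_negParams A B C (D i)) (pairwise_disjoint_negParams hD hDc hdisj hcov)
    (fun i => (hneg i).imp fun t ht => ⟨ht, hGdet t ▸ det_neg ht⟩)
    fun t ht => hGdet t ▸ det_nonneg ht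

end Pencils

section Discriminant

open Matrix

variable {Q₁ Q₂ Q₃ : MvPolynomial (Fin 3) ℝ} (h₁ : Q₁.IsHomogeneous 2) (h₂ : Q₂.IsHomogeneous 2)
  (h₃ : Q₃.IsHomogeneous 2)

include h₁ h₂ h₃

lemma isHomogeneous_discriminant : (Q₁ * Q₃ - Q₂ ^ 2).IsHomogeneous 4 :=
  (h₁.mul h₃).sub (h₂.pow 2)

lemma eval_discriminant_neg_of_pencil_neg (hs : IsSmoothCurve (Q₁ * Q₃ - Q₂ ^ 2))
    (hpos : ∀ v, 0 < eval v (Q₁ * Q₃ - Q₂ ^ 2) → 0 < eval v Q₁) {t : Fin 2 → ℝ} {x : Fin 3 → ℝ}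
    (hx : pencil (eval x Q₁) (eval x Q₂) (eval x Q₃) t < 0) :
    x ≠ 0 ∧ eval x (Q₁ * Q₃ - Q₂ ^ 2) < 0 := by
  have ht0 : t ≠ 0 := by
    rintro rfl
    simp [pencil] at hx
  have hx0 : x ≠ 0 := by
    rintro rfl
    rw [eval_zero_of_isHomogeneous h₁ two_ne_zero, eval_zero_of_isHomogeneous h₂ two_ne_zero,
      eval_zero_of_isHomogeneous h₃ two_ne_zero] at hx
    simp [pencil] at hx
  have pencil_pos_of_pos {v} (hv : 0 < eval v (Q₁ * Q₃ - Q₂ ^ 2)) :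
      0 < pencil (eval v Q₁) (eval v Q₂) (eval v Q₃) t :=
    pencil_pos (hpos v hv) (by simpa only [map_sub, map_mul, map_pow] using hv) ht0
  refine ⟨hx0, lt_of_le_of_ne (not_lt.1 fun h => (pencil_pos_of_pos h).not_gt hx) fun h => ?_⟩
  have hcont : Continuous fun v => pencil (eval v Q₁) (eval v Q₂) (eval v Q₃) t := by
    unfold pencil
    have := continuous_eval Q₁
    have := continuous_eval Q₂
    have := continuous_eval Q₃
    fun_prop
  obtain ⟨v, hv, hvt⟩ := ((hs.isSideAt_eval_pos hx0 h).frequently.and_eventually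
    (hcont.continuousAt.eventually (gt_mem_nhds hx))).exists
  exact (pencil_pos_of_pos hv).not_gt hvt

theorem card_le_three (hs : IsSmoothCurve (Q₁ * Q₃ - Q₂ ^ 2)) {ι : Type*} [Fintype ι]
    {D : ι → Set RP2} (hD : ∀ i, IsOpen (D i)) (hne : ∀ i, (D i).Nonempty)
    (hdisj : Pairwise fun i j => Disjoint (D i) (D j))
    (hneg : ⋃ i, D i = negLocus (Q₁ * Q₃ - Q₂ ^ 2))
    (hline : ∀ l : Fin 3 → ℝ, ∃ P ∈ posLocus (Q₁ * Q₃ - Q₂ ^ 2), l ⬝ᵥ P.rep = 0)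
    (hpos : posLocus (Q₁ * Q₃ - Q₂ ^ 2) ⊆ posLocus Q₁) : Fintype.card ι ≤ 3 := by
  have hF := isHomogeneous_discriminant h₁ h₂ h₃
  obtain ⟨A, hA, hAQ⟩ := exists_isSymm_eval_eq h₁
  obtain ⟨B, hB, hBQ⟩ := exists_isSymm_eval_eq h₂
  obtain ⟨C, hC, hCQ⟩ := exists_isSymm_eval_eq h₃
  have hq (t x) : x ⬝ᵥ pencil A B C t *ᵥ x = pencil (eval x Q₁) (eval x Q₂) (eval x Q₃) t := by
    rw [dotProduct_pencil_mulVec, hAQ, hBQ, hCQ]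
  have hpos' (v) (hv : 0 < eval v (Q₁ * Q₃ - Q₂ ^ 2)) : 0 < eval v Q₁ := by
    have hv0 : v ≠ 0 := by
      rintro rfl
      exact hv.ne' (eval_zero_of_isHomogeneous hF (by decide))
    exact (pr_mem_posLocus h₁ even_two hv0).1 (hpos ((pr_mem_posLocus hF (by decide) hv0).2 hv))
  have eval_disc (v) :
      eval v Q₁ * eval v Q₃ - eval v Q₂ ^ 2 = eval v (Q₁ * Q₃ - Q₂ ^ 2) := by
    simp only [map_sub, map_mul, map_pow]
  refine card_le_three_of_pencil hA hB hC (fun i => isOpen_coneOver (hD i))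
    (fun i => isDoubleCone_coneOver (D i)) ?_ ?_ ?_ ?_
  · exact fun i j hij => disjoint_left.2 fun x hx hx' => disjoint_left.1 (hdisj hij) hx.2 hx'.2
  · intro t x hx
    obtain ⟨hx0, hxF⟩ := eval_discriminant_neg_of_pencil_neg h₁ h₂ h₃ hs hpos' (hq t x ▸ hx)
    obtain ⟨i, hi⟩ := mem_iUnion.1 (hneg.ge ((pr_mem_negLocus hF (by decide) hx0).2 hxF))
    exact ⟨i, hx0, hi⟩
  · intro i
    obtain ⟨P, hP⟩ := hne i
    obtain ⟨t, ht⟩ := exists_pencil_neg ((eval_disc P.rep).trans_lt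
      (hneg.le (mem_iUnion.2 ⟨i, hP⟩)))
    exact ⟨t, P.rep, ⟨P.rep_nonzero, (pr_rep P).symm ▸ hP⟩, hq t _ ▸ ht⟩
  · intro l
    obtain ⟨P, hP, hlP⟩ := hline l
    exact ⟨P.rep, hlP, fun t ht => hq t _ ▸ pencil_pos (hpos hP) (eval_disc P.rep ▸ hP) ht⟩

lemma card_le_three_of_isPreconnected (hs : IsSmoothCurve (Q₁ * Q₃ - Q₂ ^ 2)) {ι : Type*}
    [Fintype ι] {D : ι → Set RP2} (hD : ∀ i, IsOpen (D i)) (hne : ∀ i, (D i).Nonempty)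
    (hdisj : Pairwise fun i j => Disjoint (D i) (D j))
    (hneg : ⋃ i, D i = negLocus (Q₁ * Q₃ - Q₂ ^ 2))
    (hline : ∀ l : Fin 3 → ℝ, ∃ P ∈ posLocus (Q₁ * Q₃ - Q₂ ^ 2), l ⬝ᵥ P.rep = 0)
    (hconn : IsPreconnected (posLocus (Q₁ * Q₃ - Q₂ ^ 2))) : Fintype.card ι ≤ 3 := by
  have hsub : posLocus (Q₁ * Q₃ - Q₂ ^ 2) ⊆ posLocus Q₁ ∪ negLocus Q₁ := by
    intro P (hP : 0 < eval P.rep (Q₁ * Q₃ - Q₂ ^ 2))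
    rw [← compl_zeroLocus]
    intro (h0 : eval P.rep Q₁ = 0)
    rw [map_sub, map_mul, map_pow, h0, zero_mul, zero_sub, neg_pos] at hP
    exact hP.not_ge (sq_nonneg _)
  rcases hconn.subset_or_subset (isOpen_posLocus h₁ even_two) (isOpen_negLocus h₁ even_two)
    (disjoint_posLocus_negLocus Q₁) hsub with h | h
  · exact card_le_three h₁ h₂ h₃ hs hD hne hdisj hneg hline h
  · have hF : -Q₁ * -Q₃ - (-Q₂) ^ 2 = Q₁ * Q₃ - Q₂ ^ 2 := by ring
    rw [← hF] at hs hneg hline h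
    exact card_le_three h₁.neg h₂.neg h₃.neg hs hD hne hdisj hneg hline
      (by rwa [← negLocus_neg (-Q₁), neg_neg])

theorem outside_eq_negLocus (hs : IsSmoothCurve (Q₁ * Q₃ - Q₂ ^ 2))
    (ho : ConsistsOfOvals 4 (zeroLocus (Q₁ * Q₃ - Q₂ ^ 2))) :
    outside (Q₁ * Q₃ - Q₂ ^ 2) = negLocus (Q₁ * Q₃ - Q₂ ^ 2) ∧
      ∀ l : Fin 3 → ℝ, ∃ v, l ⬝ᵥ v = 0 ∧ eval v (Q₁ * Q₃ - Q₂ ^ 2) < 0 := by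
  have hF := isHomogeneous_discriminant h₁ h₂ h₃
  have h4 : Even 4 := by decide
  have hcard : 3 ≤ ENat.card (Fin 4) := by
    rw [ENat.card_eq_coe_fintype_card, Fintype.card_fin]
    exact Nat.cast_le.2 (by decide : 3 ≤ 4)
  obtain ⟨C, hC, hCd, hCF⟩ := ho
  obtain ⟨D, D', h, hD, hout, hline⟩ := exists_isInsideOutside_outside_eq hF hs hcard hC hCd hCF
  have hconn := h.isPreconnected_iInter_outside hD
  rcases hconn.subset_or_subset (isOpen_posLocus hF h4) (isOpen_negLocus hF h4)
    (disjoint_posLocus_negLocus _) h.iInter_outside_subset with hO | hO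
  · obtain ⟨hpos, hneg⟩ := h.eq_sides hD hO
    have := card_le_three_of_isPreconnected h₁ h₂ h₃ hs (fun i => (h.isSeparation i).isOpen_left)
      h.nonempty_inside hD hneg (hpos ▸ hout ▸ hline) (hpos ▸ hconn)
    norm_num at this
  · have hneg := hout.trans (h.symm.eq_sides hD hO).1
    exact ⟨hneg, fun l => (hline l).elim fun P hP => ⟨P.rep, hP.2, hneg.le hP.1⟩⟩

end Discriminant

/-! ### Bitangents -/

section Factors

variable {σ R : Type*} [CommRing R]

lemma coeff_aeval_C_X_mul_X (p : MvPolynomial σ R) (k : ℕ) :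
    (aeval (fun i => Polynomial.C (X i) * Polynomial.X : σ → Polynomial (MvPolynomial σ R))
      p).coeff k = homogeneousComponent k p := by
  induction p using MvPolynomial.induction_on' with
  | monomial d c =>
    have h : aeval (fun i => Polynomial.C (X i) * Polynomial.X : σ → Polynomial (MvPolynomial σ R))
        (monomial d c) = Polynomial.monomial d.degree (monomial d c) := by
      rw [aeval_monomial, ← Polynomial.C_mul_X_pow_eq_monomial, monomial_eq, Finsupp.degree_apply,
        Polynomial.C_mul, mul_assoc]
      simp only [mul_pow, Finsupp.prod]
      rw [Finset.prod_mul_distrib, Finset.prod_pow_eq_pow_sum, map_prod]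
      simp only [map_pow]
      rfl
    rw [h, Polynomial.coeff_monomial, homogeneousComponent_of_mem (isHomogeneous_monomial c rfl)]
    simp only [eq_comm]
  | add p q hp hq => rw [map_add, Polynomial.coeff_add, hp, hq, map_add]

variable [IsDomain R] {p q : MvPolynomial σ R} {m n : ℕ}

/-- Under `x i ↦ x i * t`, a homogeneous polynomial becomes a monomial in `t`, and the factors of a
monomial in one variable are monomials. -/
lemma exists_isHomogeneous_of_dvd (h : q.IsHomogeneous n) (h0 : q ≠ 0) (hpq : p ∣ q) :
    ∃ k, p.IsHomogeneous k := by
  obtain ⟨s, rfl⟩ := hpq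
  let Φ := aeval (R := R) (fun i => Polynomial.C (X i) * Polynomial.X :
    σ → Polynomial (MvPolynomial σ R))
  have hΦ : Φ p * Φ s = Polynomial.monomial n (p * s) := by
    rw [← map_mul]
    ext1 k
    rw [coeff_aeval_C_X_mul_X, Polynomial.coeff_monomial, homogeneousComponent_of_mem h]
    simp only [eq_comm]
  have hne : Φ p * Φ s ≠ 0 := hΦ ▸ (Polynomial.monomial_eq_zero_iff _ _).not.2 h0
  have hp0 := left_ne_zero_of_mul hne
  have hs0 := right_ne_zero_of_mul hne
  have hdeg := Polynomial.natDegree_mul hp0 hs0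
  have htrail := Polynomial.natTrailingDegree_mul hp0 hs0
  rw [hΦ, Polynomial.natDegree_monomial_eq n h0] at hdeg
  rw [hΦ, Polynomial.natTrailingDegree_monomial h0] at htrail
  have hp := Polynomial.natTrailingDegree_le_natDegree (Φ p)
  have hs := Polynomial.natTrailingDegree_le_natDegree (Φ s)
  refine ⟨(Φ p).natDegree, fun d hd => ?_⟩
  have hcoeff : (Φ p).coeff d.degree ≠ 0 := fun h0 => hd <| by
    rw [coeff_aeval_C_X_mul_X] at h0
    rw [← coeff_zero d, ← h0, coeff_homogeneousComponent, if_pos rfl]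
  have hle := Polynomial.le_natDegree_of_ne_zero hcoeff
  have hge := Polynomial.natTrailingDegree_le_of_ne_zero hcoeff
  rw [show (Φ p).natDegree = d.degree by omega, Finsupp.degree_eq_weight_one]
  rfl

lemma isHomogeneous_right_of_mul (hp : p.IsHomogeneous m) (hp0 : p ≠ 0)
    (hpq : (p * q).IsHomogeneous (m + n)) : q.IsHomogeneous n := by
  rcases eq_or_ne q 0 with rfl | hq0
  · exact isHomogeneous_zero _ _ _
  have h0 := mul_ne_zero hp0 hq0
  obtain ⟨k, hk⟩ := exists_isHomogeneous_of_dvd hpq h0 (dvd_mul_left q p)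
  rwa [← Nat.add_left_cancel ((hp.mul hk).inj_right hpq h0)]

/-- Unique factorization, applied to `q₁ * q₃ = (q₂ + r) * (q₂ - r)`. -/
lemma exists_eq_mul_of_discriminant_eq_neg_sq {K : Type*} [Field K] {q₁ q₂ q₃ r : MvPolynomial σ K}
    (h₁ : q₁.IsHomogeneous 2) (h₂ : q₂.IsHomogeneous 2) (h₃ : q₃.IsHomogeneous 2)
    (hr : r.IsHomogeneous 2) (h : q₁ * q₃ - q₂ ^ 2 = -r ^ 2) :
    ∃ (n m : ℕ) (a b c d : MvPolynomial σ K), a.IsHomogeneous n ∧ b.IsHomogeneous n ∧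
      c.IsHomogeneous m ∧ d.IsHomogeneous m ∧ q₁ = a * c ∧ q₃ = b * d ∧ 2 * q₂ = a * d + b * c := by
  by_cases hq₁ : q₁ = 0
  · exact ⟨0, 2, 0, 1, 2 * q₂, q₃, isHomogeneous_zero _ _ _, isHomogeneous_one _ _,
      h₂.C_mul 2, h₃, by rw [hq₁, zero_mul], (one_mul _).symm, by rw [zero_mul, zero_add, one_mul]⟩
  have hprod : q₁ * q₃ = (q₂ + r) * (q₂ - r) := by linear_combination h
  obtain ⟨a, c, ⟨d, hd⟩, ⟨b, hb⟩, rfl⟩ := exists_dvd_and_dvd_of_dvd_mul (Dvd.intro _ hprod)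
  have ha0 := left_ne_zero_of_mul hq₁
  have hc0 := right_ne_zero_of_mul hq₁
  obtain ⟨n, hn⟩ := exists_isHomogeneous_of_dvd h₁ hq₁ (dvd_mul_right a c)
  obtain ⟨m, hm⟩ := exists_isHomogeneous_of_dvd h₁ hq₁ (dvd_mul_left c a)
  have hnm : n + m = 2 := (hn.mul hm).inj_right h₁ hq₁
  refine ⟨n, m, a, b, c, d, hn, isHomogeneous_right_of_mul hm hc0 ?_, hm,
    isHomogeneous_right_of_mul hn ha0 ?_, rfl, mul_left_cancel₀ hq₁ ?_, ?_⟩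
  · rw [← hb, add_comm m, hnm]
    exact h₂.sub hr
  · rw [← hd, hnm]
    exact h₂.add hr
  · rw [hprod, hd, hb]
    ring
  · linear_combination hd + hb

end Factors

section RealImaginary

variable {σ : Type*}

lemma exists_eq_map_add_I_mul_map (G : MvPolynomial σ ℂ) : ∃ u w : MvPolynomial σ ℝ,
    G = MvPolynomial.map (algebraMap ℝ ℂ) u +
      C Complex.I * MvPolynomial.map (algebraMap ℝ ℂ) w := by
  induction G using MvPolynomial.induction_on with
  | C z =>
    refine ⟨C z.re, C z.im, ?_⟩
    rw [map_C, map_C, ← C_mul, ← C_add, mul_comm]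
    exact congrArg C (Complex.re_add_im z).symm
  | add G H hG hH =>
    obtain ⟨u, w, rfl⟩ := hG
    obtain ⟨u', w', rfl⟩ := hH
    exact ⟨u + u', w + w', by simp only [map_add]; ring⟩
  | mul_X G i hG =>
    obtain ⟨u, w, rfl⟩ := hG
    exact ⟨u * X i, w * X i, by simp only [map_mul, map_X]; ring⟩

lemma coeff_map_add_I_mul_map (u w : MvPolynomial σ ℝ) (d : σ →₀ ℕ) :
    coeff d (MvPolynomial.map (algebraMap ℝ ℂ) u +
      C Complex.I * MvPolynomial.map (algebraMap ℝ ℂ) w) = ⟨coeff d u, coeff d w⟩ := by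
  rw [coeff_add, coeff_C_mul, coeff_map, coeff_map, mul_comm]
  exact (Complex.mk_eq_add_mul_I _ _).symm

/-- The real and imaginary parts `u`, `w` of the square root satisfy `2 * u * w = 0`. -/
lemma exists_eq_sq_or_eq_neg_sq {f : MvPolynomial σ ℝ} {G : MvPolynomial σ ℂ} {n : ℕ}
    (hG : G.IsHomogeneous n) (h : MvPolynomial.map (algebraMap ℝ ℂ) f = G ^ 2) :
    ∃ r : MvPolynomial σ ℝ, r.IsHomogeneous n ∧ (f = r ^ 2 ∨ f = -r ^ 2) := by
  obtain ⟨u, w, rfl⟩ := exists_eq_map_add_I_mul_map G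
  have hu : u.IsHomogeneous n := fun d hd => hG fun h0 => hd <| by
    rw [coeff_map_add_I_mul_map] at h0
    exact congrArg Complex.re h0
  have hw : w.IsHomogeneous n := fun d hd => hG fun h0 => hd <| by
    rw [coeff_map_add_I_mul_map] at h0
    exact congrArg Complex.im h0
  have hI : (C Complex.I : MvPolynomial σ ℂ) * C Complex.I = -1 := by
    rw [← C_mul, Complex.I_mul_I, C_neg, C_1]
  have hsq : MvPolynomial.map (algebraMap ℝ ℂ) (f - u ^ 2 + w ^ 2) +
      C Complex.I * MvPolynomial.map (algebraMap ℝ ℂ) (-(2 * u * w)) = 0 := by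
    simp only [map_add, map_sub, map_neg, map_mul, map_pow, h, map_ofNat]
    linear_combination (MvPolynomial.map (algebraMap ℝ ℂ) w) ^ 2 * hI
  have hcoeff (d : σ →₀ ℕ) := (coeff_map_add_I_mul_map _ _ d).symm.trans (congrArg (coeff d) hsq)
  have hre : f - u ^ 2 + w ^ 2 = 0 := MvPolynomial.ext _ _ fun d =>
    congrArg Complex.re (hcoeff d)
  have him : -(2 * u * w) = 0 := MvPolynomial.ext _ _ fun d => congrArg Complex.im (hcoeff d)
  rcases mul_eq_zero.1 (neg_eq_zero.1 him) with huw | rfl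
  · obtain rfl : u = 0 := (mul_eq_zero.1 huw).resolve_left two_ne_zero
    exact ⟨w, hw, .inr (by linear_combination hre)⟩
  · exact ⟨u, hu, .inl (by linear_combination hre)⟩

end RealImaginary

section Hyperplane

variable {K : Type*} [Field K] {N : ℕ} (l : Fin (N + 1) → K) (k : Fin (N + 1))

/-- The parametrization of the hyperplane `∑ i, l i * x i = 0` by the coordinates other than
`x k`; it is meant for `l k ≠ 0`. -/
def hyperplaneParam : Fin (N + 1) → MvPolynomial (Fin N) K :=
  k.insertNth (-∑ j, C (l (k.succAbove j) / l k) * X j) X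

/-- The restriction of a polynomial to the hyperplane `∑ i, l i * x i = 0`, as a polynomial in the
coordinates other than `x k`. -/
def restrict : MvPolynomial (Fin (N + 1)) K →ₐ[K] MvPolynomial (Fin N) K :=
  aeval (hyperplaneParam l k)

lemma isHomogeneous_hyperplaneParam (i : Fin (N + 1)) :
    (hyperplaneParam l k i).IsHomogeneous 1 := by
  rcases Fin.eq_self_or_eq_succAbove k i with rfl | ⟨j, rfl⟩
  · rw [hyperplaneParam, Fin.insertNth_apply_same]
    exact (IsHomogeneous.sum _ _ _ fun j _ => (isHomogeneous_X K j).C_mul _).neg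
  · rw [hyperplaneParam, Fin.insertNth_apply_succAbove]
    exact isHomogeneous_X K j

lemma isHomogeneous_restrict {Q : MvPolynomial (Fin (N + 1)) K} {n : ℕ} (hQ : Q.IsHomogeneous n) :
    (restrict l k Q).IsHomogeneous n := by
  have h := hQ.aeval _ (isHomogeneous_hyperplaneParam l k)
  rwa [one_mul] at h

variable {l k}

lemma sum_mul_hyperplaneParam (hk : l k ≠ 0) : ∑ i, C (l i) * hyperplaneParam l k i = 0 := by
  rw [Fin.sum_univ_succAbove _ k]
  simp only [hyperplaneParam, Fin.insertNth_apply_same, Fin.insertNth_apply_succAbove, mul_neg,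
    Finset.mul_sum, ← mul_assoc, ← C_mul, mul_div_cancel₀ _ hk, neg_add_cancel]

lemma aeval_hyperplaneParam {A : Type*} [CommRing A] [Algebra K A] (hk : l k ≠ 0)
    {x : Fin (N + 1) → A} (hx : ∑ i, algebraMap K A (l i) * x i = 0) (i : Fin (N + 1)) :
    aeval (x ∘ k.succAbove) (hyperplaneParam l k i) = x i := by
  have hsucc (j : Fin N) : aeval (x ∘ k.succAbove) (hyperplaneParam l k (k.succAbove j)) =
      x (k.succAbove j) := by
    rw [hyperplaneParam, Fin.insertNth_apply_succAbove, aeval_X, Function.comp_apply]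
  rcases Fin.eq_self_or_eq_succAbove k i with rfl | ⟨j, rfl⟩
  · have h := congrArg (aeval (x ∘ i.succAbove)) (sum_mul_hyperplaneParam hk)
    simp only [map_sum, map_mul, aeval_C, map_zero] at h
    rw [Fin.sum_univ_succAbove _ i] at h hx
    simp only [hsucc] at h
    exact (((isUnit_iff_ne_zero.2 hk).map (algebraMap K A)).mul_right_inj).1
      (add_right_cancel (h.trans hx.symm))
  · exact hsucc j

lemma aeval_restrict {A : Type*} [CommRing A] [Algebra K A] (hk : l k ≠ 0) {x : Fin (N + 1) → A}
    (hx : ∑ i, algebraMap K A (l i) * x i = 0) (Q : MvPolynomial (Fin (N + 1)) K) :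
    aeval (x ∘ k.succAbove) (restrict l k Q) = aeval x Q := by
  rw [restrict, comp_aeval_apply]
  simp only [aeval_hyperplaneParam hk hx]

lemma aeval_map_hyperplaneParam {L : Type*} [CommRing L] [Algebra K L]
    (Q : MvPolynomial (Fin (N + 1)) K) :
    aeval (fun i => MvPolynomial.map (algebraMap K L) (hyperplaneParam l k i))
      (MvPolynomial.map (algebraMap K L) Q) =
      MvPolynomial.map (algebraMap K L) (restrict l k Q) := by
  rw [aeval_map_algebraMap]
  exact (comp_aeval_apply (hyperplaneParam l k) (mapAlgHom (Algebra.ofId K L)) Q).symm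

end Hyperplane

lemma IsRealBitangent.exists_map_restrict_eq_sq {F : MvPolynomial (Fin 3) ℝ} {l : Fin 3 → ℝ}
    {k : Fin 3} (h : IsRealBitangent F l) (hk : l k ≠ 0) :
    ∃ G : MvPolynomial (Fin 2) ℂ, G.IsHomogeneous 2 ∧
      MvPolynomial.map (algebraMap ℝ ℂ) (restrict l k F) = G ^ 2 := by
  obtain ⟨-, g, q, hg, hF⟩ := h
  let ψ (i : Fin 3) : MvPolynomial (Fin 2) ℂ :=
    MvPolynomial.map (algebraMap ℝ ℂ) (hyperplaneParam l k i)
  have hline : aeval ψ (∑ i, C (l i : ℂ) * X i) = 0 := by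
    have h0 := congrArg (MvPolynomial.map (algebraMap ℝ ℂ)) (sum_mul_hyperplaneParam hk)
    simp only [map_sum, map_mul, map_C, map_zero] at h0
    simp only [map_sum, map_mul, aeval_C, aeval_X]
    exact h0
  refine ⟨aeval ψ g, ?_, ?_⟩
  · simpa only [one_mul] using
      hg.aeval ψ fun i => (isHomogeneous_hyperplaneParam l k i).map (algebraMap ℝ ℂ)
  · rw [← aeval_map_hyperplaneParam, hF, map_add, map_mul, hline, zero_mul, add_zero, map_pow]

section Splitting

variable {Q₁ Q₂ Q₃ : MvPolynomial (Fin 3) ℝ} {l : Fin 3 → ℝ}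

lemma IsRealBitangent.exists_factorization (h₁ : Q₁.IsHomogeneous 2) (h₂ : Q₂.IsHomogeneous 2)
    (h₃ : Q₃.IsHomogeneous 2) (hl : IsRealBitangent (Q₁ * Q₃ - Q₂ ^ 2) l) {v : Fin 3 → ℝ}
    (hlv : l ⬝ᵥ v = 0) (hvF : eval v (Q₁ * Q₃ - Q₂ ^ 2) < 0) :
    ∃ (n m : ℕ) (a b c d : MvPolynomial (Fin 3) ℝ), a.IsHomogeneous n ∧ b.IsHomogeneous n ∧
      c.IsHomogeneous m ∧ d.IsHomogeneous m ∧ ∀ P ∈ complexLine l,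
        aeval P.rep Q₁ = aeval P.rep a * aeval P.rep c ∧
        aeval P.rep Q₃ = aeval P.rep b * aeval P.rep d ∧
        2 * aeval P.rep Q₂ = aeval P.rep a * aeval P.rep d + aeval P.rep b * aeval P.rep c := by
  obtain ⟨k, hk⟩ := Function.ne_iff.1 hl.1
  obtain ⟨G, hG, hFG⟩ := hl.exists_map_restrict_eq_sq hk
  obtain ⟨r, hr, hFr⟩ := exists_eq_sq_or_eq_neg_sq hG hFG
  have hneg : restrict l k (Q₁ * Q₃ - Q₂ ^ 2) = -r ^ 2 := hFr.resolve_left fun h => by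
    have hv : aeval (v ∘ k.succAbove) r ^ 2 = eval v (Q₁ * Q₃ - Q₂ ^ 2) := by
      rw [← map_pow, ← h]
      exact aeval_restrict hk hlv _
    exact (hv ▸ hvF).not_ge (sq_nonneg _)
  simp only [map_sub, map_mul, map_pow] at hneg
  obtain ⟨n, m, a, b, c, d, ha, hb, hc, hd, hac, hbd, habcd⟩ :=
    exists_eq_mul_of_discriminant_eq_neg_sq (isHomogeneous_restrict l k h₁)
      (isHomogeneous_restrict l k h₂) (isHomogeneous_restrict l k h₃) hr hneg
  refine ⟨n, m, rename k.succAbove a, rename k.succAbove b, rename k.succAbove c,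
    rename k.succAbove d, ha.rename_isHomogeneous, hb.rename_isHomogeneous,
    hc.rename_isHomogeneous, hd.rename_isHomogeneous, fun P hP => ?_⟩
  have hres (Q : MvPolynomial (Fin 3) ℝ) := aeval_restrict (A := ℂ) hk hP Q
  have hmid := congrArg (aeval (P.rep ∘ k.succAbove)) habcd
  simp only [map_mul, map_add, map_ofNat] at hmid
  simp only [aeval_rename]
  exact ⟨by rw [← hres, hac, map_mul], by rw [← hres, hbd, map_mul], by rw [← hres, hmid]⟩

lemma IsSmoothCurve.aeval_ne_zero (hs : IsSmoothCurve (Q₁ * Q₃ - Q₂ ^ 2)) {x : Fin 3 → ℂ}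
    (hx : x ≠ 0) : aeval x Q₁ ≠ 0 ∨ aeval x Q₂ ≠ 0 ∨ aeval x Q₃ ≠ 0 := by
  by_contra! ⟨e₁, e₂, e₃⟩
  obtain ⟨i, hi⟩ := hs x hx (by simp [e₁, e₂])
  exact hi (by simp [Derivation.leibniz, pow_two, e₁, e₂, e₃])

/-- The complex points of the curve `t₀ a + t₁ b = 0` over the line `l`. -/
def curveOver (l : Fin 3 → ℝ) (a b : MvPolynomial (Fin 3) ℝ) :
    Set (ℙ ℂ (Fin 2 → ℂ) × ℙ ℂ (Fin 3 → ℂ)) :=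
  {p | p.2 ∈ complexLine l ∧ p.1.rep 0 * aeval p.2.rep a + p.1.rep 1 * aeval p.2.rep b = 0}

variable {a b c d : MvPolynomial (Fin 3) ℝ} {n : ℕ}

lemma isRealLineOver_curveOver (ha : a.IsHomogeneous n) (hb : b.IsHomogeneous n)
    (h : ∀ P ∈ complexLine l, aeval P.rep a ≠ 0 ∨ aeval P.rep b ≠ 0) :
    IsRealLineOver l (curveOver l a b) := by
  refine ⟨n, ![-b, a], Fin.forall_fin_two.2 ⟨hb.neg, ha⟩, fun P hP => ?_, ?_⟩
  · rcases h P hP with ha | hb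
    · exact ⟨1, ha⟩
    · exact ⟨0, by simpa using hb⟩
  · ext p
    simp only [curveOver, mem_ofPred_eq, Matrix.cons_val_zero, Matrix.cons_val_one, map_neg,
      mul_neg, eq_neg_iff_add_eq_zero]

/-- Over `P` the first curve is the single point `[-b(P) : a(P)]`. -/
lemma curveOver_ne {P : ℙ ℂ (Fin 3 → ℂ)} (hP : P ∈ complexLine l)
    (h : aeval P.rep a * aeval P.rep d - aeval P.rep b * aeval P.rep c ≠ 0) :
    curveOver l a b ≠ curveOver l c d := by
  have hab : ![-aeval P.rep b, aeval P.rep a] ≠ 0 := fun h0 => h <| by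
    have hb : -aeval P.rep b = 0 := congrFun h0 0
    have ha : aeval P.rep a = 0 := congrFun h0 1
    rw [ha, neg_eq_zero.1 hb, zero_mul, zero_mul, sub_zero]
  obtain ⟨ν, hν⟩ := Projectivization.exists_smul_eq_mk_rep ℂ _ hab
  let T : ℙ ℂ (Fin 2 → ℂ) := Projectivization.mk ℂ _ hab
  have hT₀ : T.rep 0 = ν * -aeval P.rep b := (congrFun hν 0).symm
  have hT₁ : T.rep 1 = ν * aeval P.rep a := (congrFun hν 1).symm
  intro heq
  have hmem : (T, P) ∈ curveOver l a b := ⟨hP, by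
    simp only [hT₀, hT₁]
    ring⟩
  obtain ⟨-, hcd⟩ := heq ▸ hmem
  simp only [hT₀, hT₁] at hcd
  exact mul_ne_zero ν.ne_zero h (by linear_combination hcd)

lemma exists_mem_complexLine_aeval_ne_zero {F : MvPolynomial (Fin 3) ℝ} (hF : F.IsHomogeneous n)
    {v : Fin 3 → ℝ} (hv : v ≠ 0) (hlv : l ⬝ᵥ v = 0) (hvF : eval v F ≠ 0) :
    ∃ P ∈ complexLine l, aeval P.rep F ≠ 0 := by
  let w : Fin 3 → ℂ := algebraMap ℝ ℂ ∘ v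
  have hw : w ≠ 0 := fun h => hv <| funext fun i => Complex.ofReal_eq_zero.1 (congrFun h i)
  have hlw : ∑ i, (l i : ℂ) * w i = 0 := by
    have h := congrArg (algebraMap ℝ ℂ) hlv
    simp only [dotProduct, map_sum, map_mul, map_zero] at h
    exact h
  obtain ⟨μ, hμ⟩ := Projectivization.exists_smul_eq_mk_rep ℂ w hw
  refine ⟨Projectivization.mk ℂ w hw, ?_, ?_⟩
  · change ∑ i, (l i : ℂ) * (Projectivization.mk ℂ w hw).rep i = 0
    simp only [← hμ, Pi.smul_apply, Units.smul_def, smul_eq_mul, mul_left_comm _ (μ : ℂ),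
      ← Finset.mul_sum, hlw, mul_zero]
  · rw [← hμ, Units.smul_def, aeval_smul_of_isHomogeneous hF]
    refine mul_ne_zero (pow_ne_zero _ μ.ne_zero) ?_
    rw [aeval_algebraMap_apply]
    exact Complex.ofReal_ne_zero.2 hvF

lemma delPezzo_inter_eq_union (h : ∀ P ∈ complexLine l,
    aeval P.rep Q₁ = aeval P.rep a * aeval P.rep c ∧
    aeval P.rep Q₃ = aeval P.rep b * aeval P.rep d ∧
    2 * aeval P.rep Q₂ = aeval P.rep a * aeval P.rep d + aeval P.rep b * aeval P.rep c) :
    delPezzo Q₁ Q₂ Q₃ ∩ Prod.snd ⁻¹' complexLine l = curveOver l a b ∪ curveOver l c d := by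
  ext p
  simp only [mem_inter_iff, mem_preimage, mem_union, mem_ofPred_eq, delPezzo, curveOver,
    ← and_or_left]
  rw [and_comm]
  refine and_congr_right fun hp => ?_
  obtain ⟨e₁, e₃, e₂⟩ := h p.2 hp
  rw [← mul_eq_zero, e₁, e₃]
  refine Eq.congr_left ?_
  linear_combination p.1.rep 0 * p.1.rep 1 * e₂

theorem IsRealBitangent.splitsOn (h₁ : Q₁.IsHomogeneous 2) (h₂ : Q₂.IsHomogeneous 2)
    (h₃ : Q₃.IsHomogeneous 2) (hs : IsSmoothCurve (Q₁ * Q₃ - Q₂ ^ 2))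
    (hl : IsRealBitangent (Q₁ * Q₃ - Q₂ ^ 2) l) {v : Fin 3 → ℝ} (hlv : l ⬝ᵥ v = 0)
    (hvF : eval v (Q₁ * Q₃ - Q₂ ^ 2) < 0) : SplitsOn Q₁ Q₂ Q₃ l := by
  have hF := isHomogeneous_discriminant h₁ h₂ h₃
  have hv : v ≠ 0 := by
    rintro rfl
    exact hvF.ne (eval_zero_of_isHomogeneous hF four_ne_zero)
  obtain ⟨n, m, a, b, c, d, ha, hb, hc, hd, hfac⟩ := hl.exists_factorization h₁ h₂ h₃ hlv hvF
  refine ⟨curveOver l a b, curveOver l c d, isRealLineOver_curveOver ha hb fun P hP => ?_,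
    isRealLineOver_curveOver hc hd fun P hP => ?_, ?_, delPezzo_inter_eq_union hfac⟩
  · obtain ⟨e₁, e₃, e₂⟩ := hfac P hP
    have hne := hs.aeval_ne_zero P.rep_nonzero
    contrapose! hne
    exact ⟨by simp [e₁, hne], by simpa [hne] using e₂, by simp [e₃, hne]⟩
  · obtain ⟨e₁, e₃, e₂⟩ := hfac P hP
    have hne := hs.aeval_ne_zero P.rep_nonzero
    contrapose! hne
    exact ⟨by simp [e₁, hne], by simpa [hne] using e₂, by simp [e₃, hne]⟩
  · obtain ⟨P, hP, hPF⟩ := exists_mem_complexLine_aeval_ne_zero hF hv hlv hvF.ne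
    obtain ⟨e₁, e₃, e₂⟩ := hfac P hP
    refine curveOver_ne hP fun h => hPF ?_
    -- `4 (Q₁ Q₃ - Q₂²) = -(a d - b c)²`
    simp only [map_sub, map_mul, map_pow, e₁, e₃]
    linear_combination -(1 / 4) *
      (aeval P.rep a * aeval P.rep d - aeval P.rep b * aeval P.rep c) * h - (1 / 4) *
      (2 * aeval P.rep Q₂ + aeval P.rep a * aeval P.rep d + aeval P.rep b * aeval P.rep c) * e₂

end Splitting

end RealQuartic

end

theorem lemma3p6 (Q₁ Q₂ Q₃ : MvPolynomial (Fin 3) ℝ)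
    (h₁ : Q₁.IsHomogeneous 2) (h₂ : Q₂.IsHomogeneous 2) (h₃ : Q₃.IsHomogeneous 2)
    (hsmooth : RealQuartic.IsSmoothCurve (Q₁ * Q₃ - Q₂ ^ 2))
    (hovals : RealQuartic.ConsistsOfOvals 4 (RealQuartic.zeroLocus (Q₁ * Q₃ - Q₂ ^ 2))) :
    RealQuartic.outside (Q₁ * Q₃ - Q₂ ^ 2) = RealQuartic.negLocus (Q₁ * Q₃ - Q₂ ^ 2) ∧
    ∀ l : Fin 3 → ℝ, RealQuartic.IsRealBitangent (Q₁ * Q₃ - Q₂ ^ 2) l →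
      RealQuartic.SplitsOn Q₁ Q₂ Q₃ l := by
  obtain ⟨hout, hline⟩ := RealQuartic.outside_eq_negLocus h₁ h₂ h₃ hsmooth hovals
  refine ⟨hout, fun l hl => ?_⟩
  obtain ⟨v, hlv, hvF⟩ := hline l
  exact hl.splitsOn h₁ h₂ h₃ hsmooth hlv hvF
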